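/- **Theorem 5.1.** For each $t\in\mathbb R$ let the complex-valued potentials $q(\cdot,t)$, $r(\cdot,t)$ belong to the Schwartz class $\mathcal S(\mathbb R)$ in $x$, depending continuously on $t$ in the topology of $\mathcal S(\mathbb R)$, and let their time evolution be governed by $\mathcal T$: they are differentiable in $t$, and $\mathcal X_t-\mathcal T_x+\mathcal X\mathcal T-\mathcal T\mathcal X=0$ for all $x,t\in\mathbb R$ and $\zeta\in\mathbb C$, where $$\mathcal X=\begin{bmatrix}-i\zeta^2&\zeta q\\ \zeta r&i\zeta^2+\frac i2qr\end{bmatrix},$$ $$\mathcal T=\begin{bmatrix}-2i\zeta^4-i\zeta^2qr&2\zeta^3q+\zeta(iq_x+\frac12q^2r)\\ 2\zeta^3r+\zeta(-ir_x+\frac12qr^2)&2i\zeta^4+i\zeta^2qr+\frac12(qr_x-q_xr)+\frac i4q^2r^2\end{bmatrix}.$$ Let $\lambda=\zeta^2$. For each fixed $t$, the Jost solutions $\psi,\bar\psi,\phi,\bar\phi$ are the solutions of $\frac{d}{dx}f=\mathcal Xf$ with $$\psi=\begin{bmatrix}o(1)\\ e^{i\lambda x}(1+o(1))\end{bmatrix},\quad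 \bar\psi=\begin{bmatrix}e^{-i\lambda x}(1+o(1))\\ o(1)\end{bmatrix}\quad(x\to+\infty),$$ $$\phi=\begin{bmatrix}e^{-i\lambda x}(1+o(1))\\ o(1)\end{bmatrix},\quad \bar\phi=\begin{bmatrix}o(1)\\ e^{i\lambda x}(1+o(1))\end{bmatrix}\quad(x\to-\infty)$$ (overbars do not denote complex conjugation; $\psi,\phi$ are considered for $\operatorname{Im}\lambda\ge0$, $\bar\psi,\bar\phi$ for $\operatorname{Im}\lambda\le0$). The transmission coefficients are defined by $$\frac1{T_{\rm l}}=\lim_{x\to-\infty}e^{-i\lambda x}\psi_2,\quad \frac1{\bar T_{\rm l}}=\lim_{x\to-\infty}e^{i\lambda x}\bar\psi_1,\quad \frac1{T_{\rm r}}=\lim_{x\to+\infty}e^{i\lambda x}\phi_1,\quad \frac1{\bar T_{\rm r}}=\lim_{x\to+\infty}e^{-i\lambda x}\bar\phi_2,$$ and, for $\lambda\in\mathbb R$, the reflection coefficients by $$\frac L{T_{\rm l}}=\lim_{x\to-\infty}e^{i\lambda x}\psi_1,\quad \frac{\bar L}{\bar T_{\rm l}}=\lim_{x\to-\infty}e^{-i\lambda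 x}\bar\psi_2,\quad \frac R{T_{\rm r}}=\lim_{x\to+\infty}e^{-i\lambda x}\phi_2,\quad \frac{\bar R}{\bar T_{\rm r}}=\lim_{x\to+\infty}e^{i\lambda x}\bar\phi_1.$$ (Where one of the four limits defining a $1/T$ vanishes, that $T$ and the corresponding reflection coefficient are given the conventional value $0$.) Bound-state triplets at a fixed time: let $T_{\rm r}(\sqrt\lambda)$ have exactly the distinct poles $\lambda_1,\dots,\lambda_N$ in the upper half $\lambda$-plane, with multiplicities $m_1,\dots,m_N$. The dependency constants $\gamma_{j0},\dots,\gamma_{j(m_j-1)}$ are defined by $\phi(\sqrt\lambda,x)=\Gamma_j(\lambda)\,\psi(\sqrt\lambda,x)+O((\lambda-\lambda_j)^{m_j})$ as $\lambda\to\lambda_j$ for every $x$, where $\Gamma_j(\lambda)=\sum_{k<m_j}\gamma_{jk}(\lambda-\lambda_j)^k/k!$, and the normalization constants $c_{jk}$ by $$-i\,\frac{T_{\rm r}(\sqrt\lambda)}{\sqrt\lambda}\,\Gamma_j(\lambda)=\sum_{k=0}^{m_j-1}\frac{c_{jk}}{(\lambda-\lambda_j)^{k+1}}+O(1),\qquad\lambda\to\lambda_j.$$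 $A$ is the block diagonal matrix of the upper triangular $m_j\times m_j$ Jordan blocks with eigenvalues $\lambda_j$, $B$ is the column with blocks $(0,\dots,0,1)^{\mathsf T}$, and $C$ is the row with blocks $(c_{j(m_j-1)},\dots,c_{j1},c_{j0})$. The triplet $(\bar A,\bar B,\bar C)$ is defined in the same way from the poles of $\bar T_{\rm r}$ in the lower half-plane, with $\bar\phi,\bar\psi$ in place of $\phi,\psi$ and $+i$ in place of $-i$. Then: (a) For all $t\in\mathbb R$ and all $\zeta$ with $\lambda=\zeta^2\in\mathbb R$, $$R(\zeta,t)=R(\zeta,0)e^{4i\lambda^2t},\quad \bar R(\zeta,t)=\bar R(\zeta,0)e^{-4i\lambda^2t},\quad L(\zeta,t)=L(\zeta,0)e^{-4i\lambda^2t},\quad \bar L(\zeta,t)=\bar L(\zeta,0)e^{4i\lambda^2t}.$$ (b) For all $t\in\mathbb R$, $T_{\rm l}(\zeta,t)=T_{\rm l}(\zeta,0)$ and $T_{\rm r}(\zeta,t)=T_{\rm r}(\zeta,0)$ if $\operatorname{Im}\zeta^2\ge0$, and $\bar T_{\rm l}(\zeta,t)=\bar T_{\rm l}(\zeta,0)$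 and $\bar T_{\rm r}(\zeta,t)=\bar T_{\rm r}(\zeta,0)$ if $\operatorname{Im}\zeta^2\le0$. (c) If $(A,B,C)$ is the triplet at time $0$ for the poles $\lambda_j$ with multiplicities $m_j$, then for every $t\in\mathbb R$ the same $\lambda_j$, $m_j$ list the poles at time $t$, and the triplet at time $t$ is $(A,B,C\,e^{4iA^2t})$. Likewise, if $(\bar A,\bar B,\bar C)$ is the barred triplet at time $0$, then the barred triplet at time $t$, for the same poles and multiplicities, is $(\bar A,\bar B,\bar C\,e^{-4i\bar A^2t})$. -/

import Mathlib

open Filter Topology Asymptotics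
open scoped SchwartzMap

namespace ChenLeeLiu

/-- The matrix `𝒳` of the AKNS pair, as a function of the spectral parameter `ζ` and of the values
`q`, `r` of the two potentials. -/
noncomputable def matX (ζ q r : ℂ) : Matrix (Fin 2) (Fin 2) ℂ :=
  !![-Complex.I * ζ ^ 2, ζ * q;
     ζ * r, Complex.I * ζ ^ 2 + Complex.I / 2 * q * r]

/-- The matrix `𝒯` of the AKNS pair, as a function of the spectral parameter `ζ` and of the values
`q`, `r`, `qx`, `rx` of the two potentials and of their `x`-derivatives. -/
noncomputable def matT (ζ q r qx rx : ℂ) : Matrix (Fin 2) (Fin 2) ℂ :=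
  !![-2 * Complex.I * ζ ^ 4 - Complex.I * ζ ^ 2 * q * r,
       2 * ζ ^ 3 * q + ζ * (Complex.I * qx + 1 / 2 * q ^ 2 * r);
     2 * ζ ^ 3 * r + ζ * (-Complex.I * rx + 1 / 2 * q * r ^ 2),
       2 * Complex.I * ζ ^ 4 + Complex.I * ζ ^ 2 * q * r + 1 / 2 * (q * rx - qx * r)
         + Complex.I / 4 * q ^ 2 * r ^ 2]

/-- `𝒯` along the potentials `q`, `r` (functions of `x`), evaluated at the point `x`. -/
noncomputable def matTAt (ζ : ℂ) (q r : ℝ → ℂ) (x : ℝ) : Matrix (Fin 2) (Fin 2) ℂ :=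
  matT ζ (q x) (r x) (deriv q x) (deriv r x)

/-- The time evolution of `(q, r)` is governed by `𝒯`: for every `ζ`, at every `(x, t)`, the matrix
`𝒳` is differentiable in `t` and `𝒳_t - 𝒯_x + 𝒳 𝒯 - 𝒯 𝒳 = 0` (entry by entry; the entries of `𝒯`
are smooth in `x` because the potentials are Schwartz functions of `x`). -/
def GovernedByT (q r : ℝ → 𝓢(ℝ, ℂ)) : Prop :=
  ∀ (ζ : ℂ) (x t : ℝ) (i j : Fin 2),
    HasDerivAt (fun s : ℝ => matX ζ (q s x) (r s x) i j)
      (deriv (fun y : ℝ => matTAt ζ (q t) (r t) y i j) x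
        - (matX ζ (q t x) (r t x) * matTAt ζ (q t) (r t) x
            - matTAt ζ (q t) (r t) x * matX ζ (q t x) (r t x)) i j) t

/-! ### The linear system and its Jost solutions (the overbar of the usual notation, which is not a
complex conjugation, is written `Bar`) -/

/-- `f` is a column-vector solution of the linear system `f' = 𝒳 f` on the real line. -/
def IsSolution (q r : ℝ → ℂ) (ζ : ℂ) (f : ℝ → Fin 2 → ℂ) : Prop :=
  ∀ x : ℝ, HasDerivAt f ((matX ζ (q x) (r x)).mulVec (f x)) x

/-- `e^{iζ²x}` -/
noncomputable def ePlus (ζ : ℂ) (x : ℝ) : ℂ := Complex.exp (Complex.I * ζ ^ 2 * x)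

/-- `e^{-iζ²x}` -/
noncomputable def eMinus (ζ : ℂ) (x : ℝ) : ℂ := Complex.exp (-Complex.I * ζ ^ 2 * x)

/-- `ψ = (o(1), e^{iζ²x}[1+o(1)])` as `x → +∞`. -/
def IsJostPsi (q r : ℝ → ℂ) (ζ : ℂ) (f : ℝ → Fin 2 → ℂ) : Prop :=
  IsSolution q r ζ f ∧ Tendsto (fun x => f x 0) atTop (𝓝 0) ∧
    Tendsto (fun x => eMinus ζ x * f x 1) atTop (𝓝 1)

/-- `ψ̄ = (e^{-iζ²x}[1+o(1)], o(1))` as `x → +∞`. -/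
def IsJostPsiBar (q r : ℝ → ℂ) (ζ : ℂ) (f : ℝ → Fin 2 → ℂ) : Prop :=
  IsSolution q r ζ f ∧ Tendsto (fun x => ePlus ζ x * f x 0) atTop (𝓝 1) ∧
    Tendsto (fun x => f x 1) atTop (𝓝 0)

/-- `φ = (e^{-iζ²x}[1+o(1)], o(1))` as `x → -∞`. -/
def IsJostPhi (q r : ℝ → ℂ) (ζ : ℂ) (f : ℝ → Fin 2 → ℂ) : Prop :=
  IsSolution q r ζ f ∧ Tendsto (fun x => ePlus ζ x * f x 0) atBot (𝓝 1) ∧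
    Tendsto (fun x => f x 1) atBot (𝓝 0)

/-- `φ̄ = (o(1), e^{iζ²x}[1+o(1)])` as `x → -∞`. -/
def IsJostPhiBar (q r : ℝ → ℂ) (ζ : ℂ) (f : ℝ → Fin 2 → ℂ) : Prop :=
  IsSolution q r ζ f ∧ Tendsto (fun x => f x 0) atBot (𝓝 0) ∧
    Tendsto (fun x => eMinus ζ x * f x 1) atBot (𝓝 1)

open Classical in
/-- The function with property `P` (used where there is exactly one), and `0` if there is none. -/
noncomputable def theFun (P : (ℝ → Fin 2 → ℂ) → Prop) : ℝ → Fin 2 → ℂ :=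
  if h : ∃ f, P f then h.choose else 0

/-- The Jost solution `ψ(ζ, ·)`; for Schwartz potentials it exists and is unique if `0 ≤ Im ζ²`. -/
noncomputable def psi (q r : ℝ → ℂ) (ζ : ℂ) : ℝ → Fin 2 → ℂ := theFun (IsJostPsi q r ζ)

/-- The Jost solution `ψ̄(ζ, ·)`; for Schwartz potentials it exists and is unique if
`Im ζ² ≤ 0`. -/
noncomputable def psiBar (q r : ℝ → ℂ) (ζ : ℂ) : ℝ → Fin 2 → ℂ := theFun (IsJostPsiBar q r ζ)

/-- The Jost solution `φ(ζ, ·)`; for Schwartz potentials it exists and is unique if `0 ≤ Im ζ²`. -/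
noncomputable def phi (q r : ℝ → ℂ) (ζ : ℂ) : ℝ → Fin 2 → ℂ := theFun (IsJostPhi q r ζ)

/-- The Jost solution `φ̄(ζ, ·)`; for Schwartz potentials it exists and is unique if
`Im ζ² ≤ 0`. -/
noncomputable def phiBar (q r : ℝ → ℂ) (ζ : ℂ) : ℝ → Fin 2 → ℂ := theFun (IsJostPhiBar q r ζ)

/-! ### The scattering coefficients

They are read off from the leading coefficients of the Jost solutions at the opposite spatial end:
`ψ ~ ((L/T_l) e^{-iζ²x}, (1/T_l) e^{iζ²x})` and `ψ̄ ~ ((1/T̄_l) e^{-iζ²x}, (L̄/T̄_l) e^{iζ²x})` as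
`x → -∞`, `φ ~ ((1/T_r) e^{-iζ²x}, (R/T_r) e^{iζ²x})` and
`φ̄ ~ ((R̄/T̄_r) e^{-iζ²x}, (1/T̄_r) e^{iζ²x})` as `x → +∞`.
Where a coefficient `1/T` vanishes, `T` has the conventional value `0`. -/

noncomputable def Tl (q r : ℝ → ℂ) (ζ : ℂ) : ℂ :=
  (limUnder atBot (fun x => eMinus ζ x * psi q r ζ x 1))⁻¹

noncomputable def L (q r : ℝ → ℂ) (ζ : ℂ) : ℂ :=
  Tl q r ζ * limUnder atBot (fun x => ePlus ζ x * psi q r ζ x 0)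

noncomputable def TlBar (q r : ℝ → ℂ) (ζ : ℂ) : ℂ :=
  (limUnder atBot (fun x => ePlus ζ x * psiBar q r ζ x 0))⁻¹

noncomputable def LBar (q r : ℝ → ℂ) (ζ : ℂ) : ℂ :=
  TlBar q r ζ * limUnder atBot (fun x => eMinus ζ x * psiBar q r ζ x 1)

noncomputable def Tr (q r : ℝ → ℂ) (ζ : ℂ) : ℂ :=
  (limUnder atTop (fun x => ePlus ζ x * phi q r ζ x 0))⁻¹

noncomputable def R (q r : ℝ → ℂ) (ζ : ℂ) : ℂ :=
  Tr q r ζ * limUnder atTop (fun x => eMinus ζ x * phi q r ζ x 1)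

noncomputable def TrBar (q r : ℝ → ℂ) (ζ : ℂ) : ℂ :=
  (limUnder atTop (fun x => eMinus ζ x * phiBar q r ζ x 1))⁻¹

noncomputable def RBar (q r : ℝ → ℂ) (ζ : ℂ) : ℂ :=
  TrBar q r ζ * limUnder atTop (fun x => ePlus ζ x * phiBar q r ζ x 0)

/-! ### Bound states -/

/-- The principal square root, `ζ = √λ`. -/
noncomputable def csqrt (l : ℂ) : ℂ := l ^ (1 / 2 : ℂ)

/-- `lam 0, …, lam (N-1)` are the distinct poles of `F` in the set `S`, each listed once, with
the respective multiplicities `m 0, …, m (N-1)`. -/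
def IsPoleListing (F : ℂ → ℂ) (S : Set ℂ) {N : ℕ} (lam : Fin N → ℂ) (m : Fin N → ℕ) : Prop :=
  Function.Injective lam ∧
  (∀ j, lam j ∈ S ∧ 0 < m j ∧
    meromorphicOrderAt F (lam j) = ((-(m j : ℤ) : ℤ) : WithTop ℤ)) ∧
  ∀ l ∈ S, meromorphicOrderAt F l < 0 → ∃ j, lam j = l

/-- The polynomial `∑_k γ_k (λ - λ₀)^k / k!`. -/
noncomputable def taylorPoly (l₀ : ℂ) {m : ℕ} (γ : Fin m → ℂ) (l : ℂ) : ℂ :=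
  ∑ k : Fin m, γ k / ((k : ℕ).factorial : ℂ) * (l - l₀) ^ (k : ℕ)

/-- `γ_0, …, γ_{m-1}` are the dependency constants of the pair of solutions `f`, `g` at `λ₀`: with
`ζ = √λ`, the Taylor expansions in `λ` at `λ₀` of `f(ζ, x)` and of `(∑_k γ_k (λ - λ₀)^k / k!) g(ζ, x)`
agree through order `m - 1`, for every `x`. For functions analytic in `λ` this is the same as
`∂_λ^k f = ∑_{l ≤ k} (k choose l) γ_{k-l} ∂_λ^l g` at `λ₀`, for `0 ≤ k ≤ m - 1`. -/
def IsDependency (f g : ℂ → ℝ → Fin 2 → ℂ) (l₀ : ℂ) {m : ℕ} (γ : Fin m → ℂ) : Prop :=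
  ∀ (x : ℝ) (i : Fin 2),
    (fun l : ℂ => f (csqrt l) x i - taylorPoly l₀ γ l * g (csqrt l) x i)
      =O[𝓝 l₀] fun l : ℂ => (l - l₀) ^ m

/-- `c_0, …, c_{m-1}` are the normalization constants at the pole `λ₀` of multiplicity `m` of the
transmission coefficient `T`: with the dependency constants `γ` of the pair `f`, `g`, and `ζ = √λ`,
the principal part of `σ T(ζ) ζ⁻¹ ∑_k γ_k (λ - λ₀)^k / k!` at `λ₀` is
`∑_k c_k (λ - λ₀)^{-k-1}`. -/
def IsNormalization (σ : ℂ) (T : ℂ → ℂ) (f g : ℂ → ℝ → Fin 2 → ℂ) (l₀ : ℂ) {m : ℕ}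
    (c : Fin m → ℂ) : Prop :=
  ∃ γ : Fin m → ℂ, IsDependency f g l₀ γ ∧
    (fun l : ℂ => σ * T (csqrt l) / csqrt l * taylorPoly l₀ γ l
        - ∑ k : Fin m, c k / (l - l₀) ^ ((k : ℕ) + 1))
      =O[𝓝[≠] l₀] fun _ : ℂ => (1 : ℂ)

/-- The index set of the `𝒩 = ∑ m_j` rows of the block matrices. -/
abbrev Idx {N : ℕ} (m : Fin N → ℕ) : Type := Σ j : Fin N, Fin (m j)

/-- The `m × m` Jordan block with `l` on the diagonal and `1` on the superdiagonal. -/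
def jordanBlock (l : ℂ) (m : ℕ) : Matrix (Fin m) (Fin m) ℂ :=
  Matrix.of fun a b => if a = b then l else if (a : ℕ) + 1 = b then 1 else 0

/-- The block diagonal matrix with the Jordan blocks of the `λ_j`. -/
def matA {N : ℕ} (lam : Fin N → ℂ) (m : Fin N → ℕ) : Matrix (Idx m) (Idx m) ℂ :=
  Matrix.blockDiagonal' fun j => jordanBlock (lam j) (m j)

/-- The column whose `j`-th block is `(0, …, 0, 1)`. -/
def matB {N : ℕ} (m : Fin N → ℕ) : Matrix (Idx m) Unit ℂ :=
  Matrix.of fun a _ => if (a.2 : ℕ) + 1 = m a.1 then 1 else 0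

/-- The row whose `j`-th block is `(c_{j(m_j-1)}, …, c_{j1}, c_{j0})`. -/
def matC {N : ℕ} (m : Fin N → ℕ) (c : (j : Fin N) → Fin (m j) → ℂ) : Matrix Unit (Idx m) ℂ :=
  Matrix.of fun _ a => c a.1 a.2.rev

/-- `(A, B, C)` is the matrix triplet representing the bound states of `(q, r)` at the poles `λ_j`,
with multiplicities `m_j`, of `T_r` in the upper half `λ`-plane. -/
def IsTriplet (q r : ℝ → ℂ) {N : ℕ} (lam : Fin N → ℂ) (m : Fin N → ℕ)
    (A : Matrix (Idx m) (Idx m) ℂ) (B : Matrix (Idx m) Unit ℂ) (C : Matrix Unit (Idx m) ℂ) : Prop :=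
  IsPoleListing (fun l => Tr q r (csqrt l)) {l | 0 < l.im} lam m ∧
  A = matA lam m ∧ B = matB m ∧
  ∃ c : (j : Fin N) → Fin (m j) → ℂ,
    (∀ j, IsNormalization (-Complex.I) (Tr q r) (phi q r) (psi q r) (lam j) (c j)) ∧ C = matC m c

/-- `(Ā, B̄, C̄)` is the matrix triplet representing the bound states of `(q, r)` at the poles `λ̄_j`,
with multiplicities `m̄_j`, of `T̄_r` in the lower half `λ`-plane. -/
def IsTripletBar (q r : ℝ → ℂ) {N : ℕ} (lam : Fin N → ℂ) (m : Fin N → ℕ)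
    (A : Matrix (Idx m) (Idx m) ℂ) (B : Matrix (Idx m) Unit ℂ) (C : Matrix Unit (Idx m) ℂ) : Prop :=
  IsPoleListing (fun l => TrBar q r (csqrt l)) {l | l.im < 0} lam m ∧
  A = matA lam m ∧ B = matB m ∧
  ∃ c : (j : Fin N) → Fin (m j) → ℂ,
    (∀ j, IsNormalization Complex.I (TrBar q r) (phiBar q r) (psiBar q r) (lam j) (c j)) ∧
      C = matC m c

end ChenLeeLiu

open ChenLeeLiu

/-! The zero curvature equation says that f_x = 𝒳f and f_t = 𝒯f are compatible. Take a Jost solution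
at time 0 and let it evolve, separately at each x, by g_t = 𝒯g. By compatibility the result solves
f_x = 𝒳f at every time (`hasDerivAt_of_zeroCurvature`, `isSolution_of_evolution`). As x → ±∞ the
potentials vanish uniformly on compact time intervals, 𝒯 tends to diag(-2iζ⁴, 2iζ⁴), and the two
components merely acquire the phases e^{∓2iζ⁴t} (`tendsto_evolution`). At the normalizing end,
dividing by the phase of the dominant component restores the asymptotics that characterize the Jost
solution at time t, so uniqueness identifies the two (`hasDerivAt_jost`). At the opposite end the
same division cancels the phase of the dominant component and doubles that of the other one
(`exp_mul_jost_tendsto`). Hence the transmission coefficients are constant and the reflection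
coefficients are multiplied by e^{±4iλ²t}.

The four Jost solutions are treated at once, labelled by the dominant component i and a sign δ
telling the normalizing end. Reflection and rescaling turn each into the solution of y' = ay + bz,
z' = μz + cy + dz, with Re μ ≤ 0 and integrable coefficients, that starts from (1, 0) at -∞. There
|y|² + |z|² obeys a Gronwall inequality from left to right, which yields existence, uniqueness,
limits at +∞, and bounds uniform for |ζ| ≤ Z.

For the bound states, φ and ψ carry opposite phases. After multiplication by these phases both
evolve by the same linear flow, so with κ = 4it the vector φ - e^{κλ²}Γψ at time t is controlled by
φ - Γψ at time 0, uniformly for λ near a pole (`isEvolved_jost`). In the barred case κ = -4it. So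
the dependency polynomial at time t is the Taylor polynomial of e^{κλ²}Γ and, T_r being constant,
the principal part that defines the c_{jk} becomes that of e^{κλ²} ∑ c_{jk}(λ-λ_j)^{-k-1}. This sum
is the row C applied to (λ-J)⁻¹B for the Jordan block J, and modulo bounded terms e^{κλ²} acts on
(λ-J)⁻¹B as e^{κJ²} (`isBigO_exp_mul_sum_sub`); hence C becomes Ce^{κA²}. Only O-estimates in λ
enter; analyticity of the Jost solutions in λ is never used. Uniqueness of the constants
(`IsNormalization.unique`) gives the converse implication. -/

namespace ChenLeeLiu

/-! ### Linear differential equations: global existence and Gronwall bounds -/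

section LinearODE

variable {E : Type*} [NormedAddCommGroup E] [NormedSpace ℝ E]

/-- The terms of the Peano–Baker series of `f' = A f`, `f t₀ = v`. -/
noncomputable def peanoBaker (A : ℝ → E →L[ℝ] E) (t₀ : ℝ) (v : E) : ℕ → ℝ → E
  | 0 => fun _ => v
  | n + 1 => fun t => ∫ τ in t₀..t, A τ (peanoBaker A t₀ v n τ)

theorem hasDerivAt_peanoBaker_succ [CompleteSpace E] {A : ℝ → E →L[ℝ] E} (hA : Continuous A)
    (t₀ : ℝ) (v : E) (n : ℕ) (t : ℝ) :
    HasDerivAt (peanoBaker A t₀ v (n + 1)) (A t (peanoBaker A t₀ v n t)) t := by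
  have hc : Continuous (peanoBaker A t₀ v n) := by
    induction n with
    | zero => exact continuous_const
    | succ n ih =>
      exact continuous_iff_continuousAt.2 fun s =>
        (intervalIntegral.integral_hasDerivAt_right
          ((hA.clm_apply ih).intervalIntegrable _ _)
          ((hA.clm_apply ih).stronglyMeasurableAtFilter _ _)
          (hA.clm_apply ih).continuousAt).continuousAt
  exact intervalIntegral.integral_hasDerivAt_right ((hA.clm_apply hc).intervalIntegrable _ _)
    ((hA.clm_apply hc).stronglyMeasurableAtFilter _ _) (hA.clm_apply hc).continuousAt

/-- Each integration raises the power of |t - t₀| by one and supplies the next factor of n!, so the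
series converges on every bounded interval. -/
theorem norm_peanoBaker_le {A : ℝ → E →L[ℝ] E} (t₀ : ℝ) (v : E) {K r : ℝ}
    (hK : ∀ τ, |τ - t₀| ≤ r → ‖A τ‖ ≤ K) (n : ℕ) {t : ℝ} (ht : |t - t₀| ≤ r) :
    ‖peanoBaker A t₀ v n t‖ ≤ ‖v‖ * (K ^ n * |t - t₀| ^ n / n.factorial) := by
  have hK0 : 0 ≤ K := (norm_nonneg _).trans (hK t ht)
  induction n generalizing t with
  | zero => simp [peanoBaker]
  | succ n ih =>
    have hsub : ∀ τ ∈ Set.uIoc t₀ t, |τ - t₀| ≤ |t - t₀| := fun τ hτ => by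
      exact Set.abs_sub_left_of_mem_uIcc (Set.uIoc_subset_uIcc hτ)
    have hint : MeasureTheory.IntegrableOn
        (fun τ => ‖v‖ * (K ^ (n + 1) / n.factorial) * |τ - t₀| ^ n) (Set.uIoc t₀ t) :=
      (by fun_prop : Continuous fun τ : ℝ =>
        ‖v‖ * (K ^ (n + 1) / n.factorial) * |τ - t₀| ^ n).integrableOn_uIoc
    calc ‖peanoBaker A t₀ v (n + 1) t‖
        ≤ ∫ τ in Set.uIoc t₀ t, ‖v‖ * (K ^ (n + 1) / n.factorial) * |τ - t₀| ^ n := by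
          simp only [peanoBaker]
          rw [intervalIntegral.norm_intervalIntegral_eq]
          refine MeasureTheory.norm_integral_le_of_norm_le hint ?_
          refine (MeasureTheory.ae_restrict_iff' measurableSet_uIoc).2 (.of_forall fun τ hτ => ?_)
          have h1 : |τ - t₀| ≤ r := (hsub τ hτ).trans ht
          calc _ ≤ ‖A τ‖ * ‖peanoBaker A t₀ v n τ‖ := (A τ).le_opNorm _
            _ ≤ K * (‖v‖ * (K ^ n * |τ - t₀| ^ n / n.factorial)) :=
              mul_le_mul (hK τ h1) (ih h1) (norm_nonneg _) hK0
            _ = _ := by ring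
      _ = _ := by
          rw [MeasureTheory.integral_const_mul, integral_pow_abs_sub_uIoc, Nat.factorial_succ]
          push_cast
          field_simp

/-- Linear differential equations with continuous coefficients have global solutions. -/
theorem exists_linear_ode [CompleteSpace E] {A : ℝ → E →L[ℝ] E} (hA : Continuous A) (t₀ : ℝ)
    (v : E) : ∃ f : ℝ → E, f t₀ = v ∧ ∀ t, HasDerivAt f (A t (f t)) t := by
  -- On each ball the terms are summable and their derivatives have a common summable majorant, as
  -- termwise differentiation requires.
  have key : ∀ r : ℝ, ∃ u : ℕ → ℝ, Summable u ∧
      (∀ n t, |t - t₀| ≤ r → ‖A t (peanoBaker A t₀ v n t)‖ ≤ u n) ∧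
      (∀ t, |t - t₀| ≤ r → Summable fun n => peanoBaker A t₀ v n t) := by
    intro r
    obtain ⟨K, hK⟩ := (isCompact_closedBall t₀ r).exists_bound_of_continuousOn hA.continuousOn
    have hK' : ∀ τ, |τ - t₀| ≤ r → ‖A τ‖ ≤ K := fun τ hτ => hK τ (by simpa [Real.dist_eq] using hτ)
    have hs : Summable fun n : ℕ => ‖v‖ * ((K * r) ^ n / n.factorial) :=
      (Real.summable_pow_div_factorial _).mul_left _
    have hb : ∀ n t, |t - t₀| ≤ r →
        ‖peanoBaker A t₀ v n t‖ ≤ ‖v‖ * ((K * r) ^ n / n.factorial) := fun n t ht => by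
      have hK0 : 0 ≤ K := (norm_nonneg _).trans (hK' t ht)
      refine (norm_peanoBaker_le t₀ v hK' n ht).trans ?_
      rw [mul_pow]
      gcongr
    refine ⟨_, hs.mul_left K, fun n t ht => ((A t).le_opNorm _).trans ?_,
      fun t ht => .of_norm_bounded hs fun n => hb n t ht⟩
    exact mul_le_mul (hK' t ht) (hb n t ht) (norm_nonneg _) ((norm_nonneg _).trans (hK' t ht))
  have hsum : ∀ t, Summable fun n => peanoBaker A t₀ v n t := fun t => by
    obtain ⟨_, _, _, h⟩ := key |t - t₀|
    exact h t le_rfl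
  refine ⟨fun t => v + ∑' n, peanoBaker A t₀ v (n + 1) t, ?_, fun t => ?_⟩
  · simp [peanoBaker]
  · obtain ⟨u, hu, hb, -⟩ := key (|t - t₀| + 1)
    have h := hasDerivAt_tsum_of_isPreconnected (t := Metric.ball t₀ (|t - t₀| + 1))
      (g := fun n => peanoBaker A t₀ v (n + 1)) (g' := fun n s => A s (peanoBaker A t₀ v n s))
      (y₀ := t) (y := t) hu Metric.isOpen_ball (convex_ball _ _).isPreconnected
      (fun n s _ => hasDerivAt_peanoBaker_succ hA t₀ v n s)
      (fun n s hs => hb n s (by simpa [Real.dist_eq] using (Metric.mem_ball.1 hs).le))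
      (by simp [Real.dist_eq]) ((summable_nat_add_iff 1).2 (hsum t)) (by simp [Real.dist_eq])
    have h2 : A t (v + ∑' n, peanoBaker A t₀ v (n + 1) t)
        = ∑' n, A t (peanoBaker A t₀ v n t) := by
      rw [← (A t).map_tsum (hsum t), (hsum t).tsum_eq_zero_add]
      rfl
    rw [h2]
    exact h.const_add v

/-- Gronwall in both time directions; the backward case follows by the reflection t ↦ -t. -/
theorem norm_le_gronwallBound_uIcc {f f' : ℝ → E} (hf : ∀ t, HasDerivAt f (f' t) t)
    {t₀ t₁ K ε : ℝ} (h : ∀ t ∈ Set.uIcc t₀ t₁, ‖f' t‖ ≤ K * ‖f t‖ + ε) :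
    ‖f t₁‖ ≤ gronwallBound ‖f t₀‖ K ε |t₁ - t₀| := by
  rcases le_total t₀ t₁ with h01 | h01
  · rw [abs_of_nonneg (sub_nonneg.2 h01)]
    rw [Set.uIcc_of_le h01] at h
    exact norm_le_gronwallBound_of_norm_deriv_right_le
      (fun t _ => (hf t).continuousAt.continuousWithinAt) (fun t _ => (hf t).hasDerivWithinAt)
      le_rfl (fun t ht => h t ⟨ht.1, ht.2.le⟩) t₁ ⟨h01, le_rfl⟩
  · rw [abs_sub_comm, abs_of_nonneg (sub_nonneg.2 h01)]
    rw [Set.uIcc_of_ge h01] at h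
    have hg : ∀ s, HasDerivAt (fun s => f (-s)) (-f' (-s)) s := fun s => by
      simpa [Function.comp_def] using (hf (-s)).scomp s (hasDerivAt_neg s)
    have := norm_le_gronwallBound_of_norm_deriv_right_le (a := -t₀) (b := -t₁) (K := K) (ε := ε)
      (fun t _ => (hg t).continuousAt.continuousWithinAt) (fun t _ => (hg t).hasDerivWithinAt)
      le_rfl (fun t ht => by
        rw [norm_neg]
        exact h (-t) ⟨by linarith [ht.2], by linarith [ht.1]⟩) (-t₁) ⟨by linarith, le_rfl⟩
    simpa [neg_add_eq_sub] using this

theorem norm_le_exp_of_linear_ode {A : ℝ → E →L[ℝ] E} {f : ℝ → E}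
    (hf : ∀ t, HasDerivAt f (A t (f t)) t) {t₀ t₁ K : ℝ}
    (hK : ∀ t ∈ Set.uIcc t₀ t₁, ‖A t‖ ≤ K) :
    ‖f t₁‖ ≤ ‖f t₀‖ * Real.exp (K * |t₁ - t₀|) := by
  have := norm_le_gronwallBound_uIcc hf (K := K) (ε := 0) (t₀ := t₀) (t₁ := t₁) fun t ht => by
    rw [add_zero]
    exact ((A t).le_opNorm _).trans (by gcongr; exact hK t ht)
  rwa [gronwallBound_ε0] at this

end LinearODE

/-! ### Compatibility of the x- and t-equations -/

section ZeroCurvature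

variable {E : Type*} [NormedAddCommGroup E] [NormedSpace ℝ E]

theorem gronwallBound_le_add_mul_exp {δ K ε x : ℝ} (hK : 1 ≤ K) (hε : 0 ≤ ε) :
    gronwallBound δ K ε x ≤ (δ + ε) * Real.exp (K * x) := by
  rw [gronwallBound_of_K_ne_0 (by positivity)]
  have h1 : ε / K * (Real.exp (K * x) - 1) ≤ ε * Real.exp (K * x) := by
    have h2 : ε / K ≤ ε := div_le_self hε hK
    have h3 : 0 ≤ ε / K := by positivity
    nlinarith [Real.exp_pos (K * x)]
  linarith [add_mul δ ε (Real.exp (K * x))]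

/-- Differentiability of an operator-valued map, uniformly in a compact parameter range. -/
theorem eventually_norm_sub_sub_smul_le {F : Type*} [NormedAddCommGroup F] [NormedSpace ℝ F]
    {T Tx : ℝ → ℝ → F}
    (hT : ∀ x t, HasDerivAt (fun y => T y t) (Tx x t) x)
    (hTx : Continuous fun p : ℝ × ℝ => Tx p.1 p.2) (x : ℝ) {J : Set ℝ} (hJ : IsCompact J)
    {ε : ℝ} (hε : 0 < ε) :
    ∀ᶠ y in 𝓝 x, ∀ s ∈ J, ‖T y s - T x s - (y - x) • Tx x s‖ ≤ ε * ‖y - x‖ := by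
  have h := hJ.mem_uniformity_of_prod (f := Tx) (s := Set.univ) (q := x)
    (u := {p | dist p.1 p.2 < ε}) (by exact hTx.continuousOn) (Set.mem_univ _)
    (Metric.dist_mem_uniformity hε)
  obtain ⟨v, hv, hvu⟩ := h
  rw [nhdsWithin_univ] at hv
  obtain ⟨r, hr, hrv⟩ := Metric.mem_nhds_iff.1 hv
  filter_upwards [Metric.ball_mem_nhds x hr] with y hy s hs
  have := (convex_ball x r).norm_image_sub_le_of_norm_hasDerivWithin_le
    (f := fun z => T z s - (z - x) • Tx x s) (f' := fun z => Tx z s - Tx x s) (C := ε)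
    (x := x) (y := y)
    (fun z _ => by
      have h1 : HasDerivAt (fun z : ℝ => (z - x) • Tx x s) ((1 : ℝ) • Tx x s) z :=
        ((hasDerivAt_id z).sub_const x).smul_const _
      rw [one_smul] at h1
      exact ((hT z s).fun_sub h1).hasDerivWithinAt)
    (fun z hz => by
      have := hvu z (hrv hz) s hs
      simp only [Set.mem_ofPred_eq] at this
      rw [← dist_eq_norm]
      exact this.le)
    (Metric.mem_ball_self hr) hy
  simpa [sub_right_comm] using this

/-- If `g_t = T g` and `g_x = M g` at `t = 0`, and `T`, `M` satisfy the zero curvature condition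
`M_t = T_x - M T + T M`, then `g_x = M g` at all times. -/
theorem hasDerivAt_of_zeroCurvature {T Tx M : ℝ → ℝ → E →L[ℝ] E} {g : ℝ → ℝ → E}
    (hT : ∀ x t, HasDerivAt (fun y => T y t) (Tx x t) x) (hTc : ∀ x, Continuous (T x))
    (hTx : Continuous fun p : ℝ × ℝ => Tx p.1 p.2)
    (hM : ∀ x t, HasDerivAt (M x) (Tx x t - (M x t).comp (T x t) + (T x t).comp (M x t)) t)
    (hg : ∀ x t, HasDerivAt (g x) (T x t (g x t)) t)
    (h0 : ∀ x, HasDerivAt (fun y => g y 0) (M x 0 (g x 0)) x) (x t : ℝ) :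
    HasDerivAt (fun y => g y t) (M x t (g x t)) x := by
  -- `W` is the candidate x-derivative. By zero curvature, (T_x - MT + TM)g + MTg = T_x g + TW, so
  -- `W` solves the formal x-derivative of the equation for `g`. No differentiability of `g` in x at
  -- positive times is presupposed.
  set W : ℝ → E := fun s => M x s (g x s) with hWdef
  have hW : ∀ s, HasDerivAt W (Tx x s (g x s) + T x s (W s)) s := fun s => by
    convert (hM x s).clm_apply (hg x s) using 1
    simp only [hWdef, add_apply, sub_apply, ContinuousLinearMap.comp_apply]
    abel
  have hJ : IsCompact (Set.uIcc 0 t) := isCompact_uIcc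
  have hgc : Continuous (g x) := continuous_iff_continuousAt.2 fun s => (hg x s).continuousAt
  have hWc : Continuous W := continuous_iff_continuousAt.2 fun s => (hW s).continuousAt
  have hTxx : Continuous fun s => Tx x s := hTx.comp (by fun_prop : Continuous fun s => (x, s))
  obtain ⟨G₁, hG₁⟩ := hJ.exists_bound_of_continuousOn hgc.continuousOn
  obtain ⟨G₂, hG₂⟩ := hJ.exists_bound_of_continuousOn hWc.continuousOn
  obtain ⟨K₁, hK₁⟩ := hJ.exists_bound_of_continuousOn (hTc x).continuousOn
  obtain ⟨K₂, hK₂⟩ := hJ.exists_bound_of_continuousOn hTxx.continuousOn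
  have h0J : (0 : ℝ) ∈ Set.uIcc 0 t := Set.left_mem_uIcc
  have hG₁0 := (norm_nonneg _).trans (hG₁ 0 h0J)
  have hG₂0 := (norm_nonneg _).trans (hG₂ 0 h0J)
  have hK₁0 := (norm_nonneg _).trans (hK₁ 0 h0J)
  have hK₂0 := (norm_nonneg _).trans (hK₂ 0 h0J)
  rw [hasDerivAt_iff_isLittleO, isLittleO_iff]
  intro c hc
  -- `Q` is chosen so that the final Gronwall bound is exactly ε Q ‖y - x‖.
  set Q : ℝ := (1 + G₁ + G₂) * Real.exp ((K₁ + 2) * |t|) with hQ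
  have hQ0 : 0 < Q := by positivity
  set ε : ℝ := min (c / Q) 1 with hεdef
  have hε : 0 < ε := by positivity
  have hε1 : ε ≤ 1 := min_le_right _ _
  have hεc : ε * Q ≤ c := by
    calc ε * Q ≤ c / Q * Q := by gcongr; exact min_le_left _ _
      _ = c := by field_simp
  have hnear : ∀ᶠ y in 𝓝 x, ‖y - x‖ * (1 + K₂) < ε := by
    have : Tendsto (fun y : ℝ => ‖y - x‖ * (1 + K₂)) (𝓝 x) (𝓝 (‖x - x‖ * (1 + K₂))) :=
      (by fun_prop : Continuous fun y : ℝ => ‖y - x‖ * (1 + K₂)).continuousAt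
    rw [sub_self, norm_zero, zero_mul] at this
    exact this.eventually (gt_mem_nhds hε)
  filter_upwards [eventually_norm_sub_sub_smul_le hT hTx x hJ hε, hnear,
    (isLittleO_iff.1 (hasDerivAt_iff_isLittleO.1 (h0 x))) hε] with y hy1 hy2 hy3
  have hTsub : ∀ s ∈ Set.uIcc 0 t, ‖T y s - T x s‖ ≤ ε := fun s hs => by
    calc ‖T y s - T x s‖ = ‖(T y s - T x s - (y - x) • Tx x s) + (y - x) • Tx x s‖ := by
          congr 1; abel
      _ ≤ ε * ‖y - x‖ + ‖y - x‖ * K₂ := by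
          refine (norm_add_le _ _).trans (add_le_add (hy1 s hs) ?_)
          rw [norm_smul]
          gcongr
          exact hK₂ s hs
      _ ≤ ‖y - x‖ * (1 + K₂) := by nlinarith [norm_nonneg (y - x)]
      _ ≤ ε := hy2.le
  -- The first-order error solves g_t = Tg up to a forcing term of size O(ε‖y - x‖), and at time 0
  -- it is at most ε‖y - x‖ by `h0`.
  have hD : ∀ s, HasDerivAt (fun s => g y s - g x s - (y - x) • W s)
      (T y s (g y s) - T x s (g x s) - (y - x) • (Tx x s (g x s) + T x s (W s))) s := fun s =>
    ((hg y s).fun_sub (hg x s)).fun_sub ((hW s).const_smul (y - x))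
  have hbound := norm_le_gronwallBound_uIcc hD (t₀ := 0) (t₁ := t) (K := K₁ + 2)
    (ε := ε * ‖y - x‖ * (G₁ + G₂)) fun s hs => by
      have h1 : T y s (g y s) - T x s (g x s) - (y - x) • (Tx x s (g x s) + T x s (W s))
          = T y s (g y s - g x s - (y - x) • W s)
            + (T y s - T x s - (y - x) • Tx x s) (g x s) + (y - x) • (T y s - T x s) (W s) := by
        simp only [map_sub, map_smul, sub_apply, smul_apply, smul_add, smul_sub]
        abel
      have h2 : ‖T y s‖ ≤ K₁ + 2 := by
        calc ‖T y s‖ ≤ ‖T x s‖ + ‖T y s - T x s‖ := by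
              simpa using norm_add_le (T x s) (T y s - T x s)
          _ ≤ K₁ + 2 := by linarith [hK₁ s hs, hTsub s hs]
      have h3 : ‖(T y s - T x s - (y - x) • Tx x s) (g x s)‖ ≤ ε * ‖y - x‖ * G₁ :=
        (ContinuousLinearMap.le_opNorm _ _).trans
          (mul_le_mul (hy1 s hs) (hG₁ s hs) (norm_nonneg _) (by positivity))
      have h4 : ‖(y - x) • (T y s - T x s) (W s)‖ ≤ ε * ‖y - x‖ * G₂ := by
        rw [norm_smul]
        calc _ ≤ ‖y - x‖ * (ε * G₂) := by
              gcongr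
              exact (ContinuousLinearMap.le_opNorm _ _).trans
                (mul_le_mul (hTsub s hs) (hG₂ s hs) (norm_nonneg _) hε.le)
          _ = _ := by ring
      rw [h1]
      refine (norm_add₃_le).trans ?_
      have h5 : ‖T y s (g y s - g x s - (y - x) • W s)‖
          ≤ (K₁ + 2) * ‖g y s - g x s - (y - x) • W s‖ :=
        (ContinuousLinearMap.le_opNorm _ _).trans (by gcongr)
      linarith
  rw [sub_zero] at hbound
  calc ‖g y t - g x t - (y - x) • M x t (g x t)‖
      ≤ (ε * ‖y - x‖ + ε * ‖y - x‖ * (G₁ + G₂)) * Real.exp ((K₁ + 2) * |t|) := by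
        refine (hbound.trans (gronwallBound_le_add_mul_exp (by linarith) (by positivity))).trans ?_
        gcongr
    _ = ε * Q * ‖y - x‖ := by rw [hQ]; ring
    _ ≤ c * ‖y - x‖ := by gcongr

end ZeroCurvature

/-- A `2 × 2` complex matrix as a real-linear operator. -/
noncomputable def op : Matrix (Fin 2) (Fin 2) ℂ →ₗ[ℝ] ((Fin 2 → ℂ) →L[ℝ] (Fin 2 → ℂ)) where
  toFun M := LinearMap.toContinuousLinearMap (M.mulVecLin.restrictScalars ℝ)
  map_add' M N := by ext1 v; simp
  map_smul' c M := by ext1 v; simp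

theorem op_apply (M : Matrix (Fin 2) (Fin 2) ℂ) (v : Fin 2 → ℂ) : op M v = M.mulVec v := rfl

theorem op_mul (M N : Matrix (Fin 2) (Fin 2) ℂ) : op (M * N) = (op M).comp (op N) := by
  ext1 v; simp only [op_apply, ContinuousLinearMap.comp_apply, Matrix.mulVec_mulVec]

theorem continuous_op : Continuous op := op.continuous_of_finiteDimensional

theorem hasDerivAt_op {M : ℝ → Matrix (Fin 2) (Fin 2) ℂ} {M' : Matrix (Fin 2) (Fin 2) ℂ} {x : ℝ}
    (h : ∀ i j, HasDerivAt (fun y => M y i j) (M' i j) x) :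
    HasDerivAt (fun y => op (M y)) (op M') x := by
  let L : (Fin 2 → Fin 2 → ℂ) →L[ℝ] ((Fin 2 → ℂ) →L[ℝ] (Fin 2 → ℂ)) :=
    LinearMap.toContinuousLinearMap
      (op.comp (Matrix.ofLinearEquiv ℝ : (Fin 2 → Fin 2 → ℂ) ≃ₗ[ℝ] _).toLinearMap)
  exact L.hasFDerivAt.comp_hasDerivAt x
    (hasDerivAt_pi.2 fun i => hasDerivAt_pi.2 fun j => h i j)

/-! ### The normalized system on the line: estimates and uniqueness -/

section HalfLine

theorem norm_sub_le_of_norm_deriv_le {E : Type*} [NormedAddCommGroup E] [NormedSpace ℝ E]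
    {h h' : ℝ → E} {w W : ℝ → ℝ} {C s x : ℝ} (hh : ∀ τ, HasDerivAt h (h' τ) τ)
    (hW : ∀ τ, HasDerivAt W (w τ) τ) (hsx : s ≤ x)
    (hb : ∀ τ ∈ Set.Icc s x, ‖h' τ‖ ≤ C * w τ) : ‖h x - h s‖ ≤ C * (W x - W s) := by
  refine image_norm_le_of_norm_deriv_right_le_deriv_boundary (f := fun τ => h τ - h s) (a := s)
    (b := x) (f' := h') (B := fun τ => C * (W τ - W s)) (B' := fun τ => C * w τ)
    (fun τ _ => ((hh τ).sub_const _).continuousAt.continuousWithinAt)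
    (fun τ _ => ((hh τ).sub_const _).hasDerivWithinAt) (by simp)
    (fun τ => ((hW τ).sub_const _).const_mul C)
    (fun τ hτ => hb τ ⟨hτ.1, hτ.2.le⟩) ⟨hsx, le_rfl⟩

theorem le_mul_exp_of_deriv_le {N N' w W : ℝ → ℝ} {s x : ℝ} (hN : ∀ τ, HasDerivAt N (N' τ) τ)
    (hW : ∀ τ, HasDerivAt W (w τ) τ) (hsx : s ≤ x)
    (hb : ∀ τ ∈ Set.Icc s x, N' τ ≤ 2 * w τ * N τ) :
    N x ≤ N s * Real.exp (2 * (W x - W s)) := by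
  have hder : ∀ τ, HasDerivAt (fun τ => N τ * Real.exp (-2 * W τ))
      ((N' τ - 2 * w τ * N τ) * Real.exp (-2 * W τ)) τ := fun τ => by
    refine ((hN τ).fun_mul (((hW τ).const_mul (-2)).exp)).congr_deriv ?_
    ring
  have hanti : AntitoneOn (fun τ => N τ * Real.exp (-2 * W τ)) (Set.Icc s x) := by
    refine antitoneOn_of_deriv_nonpos (convex_Icc s x)
      (fun τ _ => (hder τ).continuousAt.continuousWithinAt)
      (fun τ _ => (hder τ).differentiableAt.differentiableWithinAt) fun τ hτ => ?_
    rw [interior_Icc] at hτ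
    rw [(hder τ).deriv]
    exact mul_nonpos_of_nonpos_of_nonneg
      (sub_nonpos.2 (hb τ ⟨hτ.1.le, hτ.2.le⟩)) (Real.exp_pos _).le
  have := hanti ⟨le_rfl, hsx⟩ ⟨hsx, le_rfl⟩ hsx
  simp only at this
  have h2 := mul_le_mul_of_nonneg_right this (Real.exp_pos (2 * W x)).le
  rw [mul_assoc, mul_assoc, ← Real.exp_add, ← Real.exp_add] at h2
  simp only [neg_mul, neg_add_cancel, Real.exp_zero, mul_one] at h2
  rwa [mul_sub, sub_eq_neg_add]

/-- The matrix of the system `y' = a y + b z`, `z' = μ z + c y + d z`. -/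
def normMat (μ : ℂ) (a b c d : ℝ → ℂ) (x : ℝ) : Matrix (Fin 2) (Fin 2) ℂ :=
  !![a x, b x; c x, μ + d x]

/-- `f = (y, z)` solves `y' = a y + b z`, `z' = μ z + c y + d z`. -/
def NormSys (μ : ℂ) (a b c d : ℝ → ℂ) (f : ℝ → Fin 2 → ℂ) : Prop :=
  ∀ x, HasDerivAt f (op (normMat μ a b c d x) (f x)) x

/-- `W` is the primitive, vanishing at `-∞` and bounded by `I`, of a function `w` that dominates the
coefficients `a`, `b`, `c`, `d`. -/
structure Dominates (w W : ℝ → ℝ) (I : ℝ) (a b c d : ℝ → ℂ) : Prop where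
  le : ∀ x, ‖a x‖ + ‖b x‖ + ‖c x‖ + ‖d x‖ ≤ w x
  deriv : ∀ x, HasDerivAt W (w x) x
  lim : Tendsto W atBot (𝓝 0)
  bound : ∀ x, W x ≤ I

namespace Dominates

variable {w W : ℝ → ℝ} {I : ℝ} {a b c d : ℝ → ℂ}

theorem w_nonneg (h : Dominates w W I a b c d) (x : ℝ) : 0 ≤ w x :=
  le_trans (by positivity) (h.le x)

theorem mono (h : Dominates w W I a b c d) : Monotone W :=
  monotone_of_hasDerivAt_nonneg h.deriv h.w_nonneg

theorem nonneg (h : Dominates w W I a b c d) (x : ℝ) : 0 ≤ W x :=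
  h.mono.le_of_tendsto h.lim x

theorem sub_le (h : Dominates w W I a b c d) (s x : ℝ) : W x - W s ≤ I := by
  linarith [h.bound x, h.nonneg s]

end Dominates

namespace NormSys

variable {μ : ℂ} {a b c d : ℝ → ℂ} {f g : ℝ → Fin 2 → ℂ} {w W : ℝ → ℝ} {I : ℝ}

theorem deriv_zero (h : NormSys μ a b c d f) (x : ℝ) :
    HasDerivAt (fun x => f x 0) (a x * f x 0 + b x * f x 1) x := by
  simpa [op_apply, normMat, Matrix.mulVec, dotProduct, Fin.sum_univ_two]
    using hasDerivAt_pi.1 (h x) 0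

theorem deriv_one (h : NormSys μ a b c d f) (x : ℝ) :
    HasDerivAt (fun x => f x 1) (μ * f x 1 + c x * f x 0 + d x * f x 1) x := by
  refine (hasDerivAt_pi.1 (h x) 1).congr_deriv ?_
  simp only [op_apply, normMat, Matrix.mulVec, dotProduct, Fin.sum_univ_two, Matrix.of_apply,
    Matrix.cons_val_zero, Matrix.cons_val_one]
  ring

theorem sub (hf : NormSys μ a b c d f) (hg : NormSys μ a b c d g) :
    NormSys μ a b c d (fun x => f x - g x) := fun x => by
  rw [map_sub]
  exact (hf x).fun_sub (hg x)

/-- Since Re μ ≤ 0, the term μz can only decrease |y|² + |z|²; the other coefficients contribute at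
most 2w times this energy. -/
theorem energy (hf : NormSys μ a b c d f) (hμ : μ.re ≤ 0) (hw : Dominates w W I a b c d)
    {s x : ℝ} (hsx : s ≤ x) :
    ‖f x 0‖ ^ 2 + ‖f x 1‖ ^ 2
      ≤ (‖f s 0‖ ^ 2 + ‖f s 1‖ ^ 2) * Real.exp (2 * (W x - W s)) := by
  refine le_mul_exp_of_deriv_le (N := fun x => ‖f x 0‖ ^ 2 + ‖f x 1‖ ^ 2)
    (fun τ => (hf.deriv_zero τ).norm_sq.fun_add (hf.deriv_one τ).norm_sq) hw.deriv hsx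
    fun τ _ => ?_
  have hi : ∀ u v : ℂ, inner ℝ u v ≤ ‖u‖ * ‖v‖ := fun u v => real_inner_le_norm u v
  have h0 : inner ℝ (f τ 1) (μ * f τ 1) ≤ 0 := by
    have : inner ℝ (f τ 1) (μ * f τ 1) = μ.re * ‖f τ 1‖ ^ 2 := by
      rw [Complex.inner, mul_assoc, Complex.mul_conj, Complex.re_mul_ofReal,
        Complex.normSq_eq_norm_sq]
    rw [this]
    exact mul_nonpos_of_nonpos_of_nonneg hμ (by positivity)
  have h1 := hi (f τ 0) (a τ * f τ 0)
  have h2 := hi (f τ 0) (b τ * f τ 1)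
  have h3 := hi (f τ 1) (c τ * f τ 0)
  have h4 := hi (f τ 1) (d τ * f τ 1)
  simp only [inner_add_right, norm_mul] at *
  have hw' := hw.le τ
  set Y := ‖f τ 0‖
  set Z := ‖f τ 1‖
  have hYZ : Y * Z ≤ Y ^ 2 + Z ^ 2 := by nlinarith [sq_nonneg (Y - Z), sq_nonneg (Y + Z)]
  have e1 : ‖a τ‖ * Y ^ 2 ≤ ‖a τ‖ * (Y ^ 2 + Z ^ 2) := by gcongr; nlinarith [sq_nonneg Z]
  have e2 : ‖b τ‖ * (Y * Z) ≤ ‖b τ‖ * (Y ^ 2 + Z ^ 2) := by gcongr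
  have e3 : ‖c τ‖ * (Y * Z) ≤ ‖c τ‖ * (Y ^ 2 + Z ^ 2) := by gcongr
  have e4 : ‖d τ‖ * Z ^ 2 ≤ ‖d τ‖ * (Y ^ 2 + Z ^ 2) := by gcongr; nlinarith [sq_nonneg Y]
  have e5 := mul_le_mul_of_nonneg_right hw' (by positivity : 0 ≤ Y ^ 2 + Z ^ 2)
  nlinarith

/-- The second component is driven by the first one. -/
theorem norm_one_sq_le (hf : NormSys μ a b c d f) (hμ : μ.re ≤ 0) (hw : Dominates w W I a b c d)
    {s x C : ℝ} (hsx : s ≤ x) (hC : ∀ τ ∈ Set.Icc s x, ‖f τ 0‖ ≤ C) :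
    ‖f x 1‖ ^ 2 ≤ (C ^ 2 + ‖Complex.exp (-μ * (s - x)) * f s 1‖ ^ 2)
      * Real.exp (2 * (W x - W s)) - C ^ 2 := by
  -- The integrating factor removes μ. It equals 1 at τ = x and has norm at most 1 for τ ≤ x.
  set ξ : ℝ → ℂ := fun τ => Complex.exp (-μ * (τ - x)) * f τ 1 with hξ
  have hξd : ∀ τ : ℝ, HasDerivAt ξ
      (Complex.exp (-μ * (τ - x)) * (c τ * f τ 0) + d τ * ξ τ) τ := fun τ => by
    have h1 : HasDerivAt (fun τ : ℝ => Complex.exp (-μ * (τ - x)))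
        (Complex.exp (-μ * (τ - x)) * (-μ * 1)) τ :=
      ((((Complex.ofRealCLM.hasDerivAt (x := τ)).sub_const (x : ℂ)).const_mul (-μ))).cexp
    refine (h1.fun_mul (hf.deriv_one τ)).congr_deriv ?_
    simp only [hξ]
    ring
  have hC0 : 0 ≤ C := (norm_nonneg _).trans (hC s ⟨le_rfl, hsx⟩)
  -- Adding C² absorbs the forcing by the first component, leaving a homogeneous inequality N' ≤
  -- 2wN.
  have key := le_mul_exp_of_deriv_le (N := fun τ => C ^ 2 + ‖ξ τ‖ ^ 2)
    (fun τ => ((hξd τ).norm_sq).const_add _) hw.deriv hsx fun τ hτ => by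
      have hi : ∀ u v : ℂ, inner ℝ u v ≤ ‖u‖ * ‖v‖ := fun u v => real_inner_le_norm u v
      have he : ‖Complex.exp (-μ * (τ - x))‖ ≤ 1 := by
        rw [Complex.norm_exp, Real.exp_le_one_iff]
        have : (-μ * ((τ : ℂ) - x)).re = -μ.re * (τ - x) := by
          rw [← Complex.ofReal_sub, Complex.re_mul_ofReal, Complex.neg_re]
        rw [this]
        exact mul_nonpos_of_nonneg_of_nonpos (by linarith) (by linarith [hτ.2])
      have h1 := hi (ξ τ) (Complex.exp (-μ * (τ - x)) * (c τ * f τ 0))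
      have h2 := hi (ξ τ) (d τ * ξ τ)
      simp only [inner_add_right, norm_mul] at *
      have hw' := hw.le τ
      set Z := ‖ξ τ‖
      have hZ0 : 0 ≤ Z := norm_nonneg _
      have e0 : ‖Complex.exp (-μ * (τ - x))‖ * (‖c τ‖ * ‖f τ 0‖) ≤ 1 * (‖c τ‖ * C) := by
        gcongr
        exact hC τ hτ
      have e1 := mul_le_mul_of_nonneg_left e0 hZ0
      have e2 : ‖c τ‖ * (Z * C) ≤ ‖c τ‖ * (C ^ 2 + Z ^ 2) := by
        gcongr
        nlinarith [sq_nonneg (Z - C), sq_nonneg (Z + C)]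
      have e3 : ‖d τ‖ * Z ^ 2 ≤ ‖d τ‖ * (C ^ 2 + Z ^ 2) := by gcongr; nlinarith [sq_nonneg C]
      have e5 := mul_le_mul_of_nonneg_right
        (show ‖c τ‖ + ‖d τ‖ ≤ w τ by linarith [norm_nonneg (a τ), norm_nonneg (b τ)])
        (by positivity : 0 ≤ C ^ 2 + Z ^ 2)
      nlinarith
  have hx : ξ x = f x 1 := by simp [hξ]
  simp only [hx] at key
  have hs : ξ s = Complex.exp (-μ * (s - x)) * f s 1 := rfl
  rw [hs] at key
  linarith

end NormSys

/-- `f = (y, z)` is the solution with `y → 1`, `e^{-μx/2} z → 0` as `x → -∞`. -/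
structure IsNormJost (μ : ℂ) (a b c d : ℝ → ℂ) (f : ℝ → Fin 2 → ℂ) : Prop where
  sys : NormSys μ a b c d f
  lim_zero : Tendsto (fun x => f x 0) atBot (𝓝 1)
  lim_one : Tendsto (fun x : ℝ => Complex.exp (-μ / 2 * x) * f x 1) atBot (𝓝 0)

namespace IsNormJost

variable {μ : ℂ} {a b c d : ℝ → ℂ} {f g : ℝ → Fin 2 → ℂ} {w W : ℝ → ℝ} {I : ℝ}

/-- The weak condition in `IsNormJost` removes the initial term of `norm_one_sq_le` as s → -∞. What
remains is C²(e^{2W(x)} - 1), with C = 2 a bound for y near -∞, and this tends to 0 with W. -/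
theorem tendsto_one (hf : IsNormJost μ a b c d f) (hμ : μ.re ≤ 0)
    (hw : Dominates w W I a b c d) : Tendsto (fun x => f x 1) atBot (𝓝 0) := by
  have hexp : Tendsto (fun s : ℝ => Complex.exp (-μ * s) * f s 1) atBot (𝓝 0) := by
    have h1 : ∀ s : ℝ, Complex.exp (-μ * s) * f s 1
        = Complex.exp (-μ / 2 * s) * (Complex.exp (-μ / 2 * s) * f s 1) := fun s => by
      rw [← mul_assoc, ← Complex.exp_add]
      ring_nf
    simp only [h1]
    refine squeeze_zero_norm' ?_ (tendsto_zero_iff_norm_tendsto_zero.1 hf.lim_one)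
    filter_upwards [eventually_le_atBot (0 : ℝ)] with s hs
    rw [norm_mul]
    refine mul_le_of_le_one_left (norm_nonneg _) ?_
    rw [Complex.norm_exp, Real.exp_le_one_iff, Complex.re_mul_ofReal]
    have : (-μ / 2).re = -μ.re / 2 := by simp
    rw [this]
    exact mul_nonpos_of_nonneg_of_nonpos (by linarith) hs
  obtain ⟨x₀, hx₀⟩ := eventually_atBot.1
    (hf.lim_zero.norm.eventually (gt_mem_nhds (show ‖(1 : ℂ)‖ < 2 by norm_num)))
  have hle : ∀ x ≤ x₀, ‖f x 1‖ ^ 2 ≤ 2 ^ 2 * Real.exp (2 * W x) - 2 ^ 2 := by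
    intro x hx
    have h2 : Tendsto (fun s : ℝ => (2 ^ 2 + ‖Complex.exp (-μ * (s - x)) * f s 1‖ ^ 2)
        * Real.exp (2 * (W x - W s)) - 2 ^ 2) atBot
        (𝓝 ((2 ^ 2 + ‖Complex.exp (μ * x) * (0 : ℂ)‖ ^ 2) * Real.exp (2 * (W x - 0)) - 2 ^ 2)) := by
      have h3 : ∀ s : ℝ, Complex.exp (-μ * (s - x)) * f s 1
          = Complex.exp (μ * x) * (Complex.exp (-μ * s) * f s 1) := fun s => by
        rw [← mul_assoc, ← Complex.exp_add]
        ring_nf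
      simp only [h3]
      exact ((((hexp.const_mul _).norm.pow 2).const_add _).mul
        (Real.continuous_exp.continuousAt.tendsto.comp
          ((hw.lim.const_sub (W x)).const_mul 2))).sub_const _
    simp only [mul_zero, norm_zero, sub_zero, ne_eq, OfNat.ofNat_ne_zero, not_false_eq_true,
      zero_pow, add_zero] at h2
    refine ge_of_tendsto h2 ?_
    filter_upwards [eventually_le_atBot x] with s hs
    exact hf.sys.norm_one_sq_le hμ hw hs fun τ hτ => (hx₀ τ (hτ.2.trans hx)).le
  have hsq : Tendsto (fun x => ‖f x 1‖ ^ 2) atBot (𝓝 0) := by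
    have hlim : Tendsto (fun x => 2 ^ 2 * Real.exp (2 * W x) - 2 ^ 2) atBot
        (𝓝 (2 ^ 2 * Real.exp (2 * 0) - 2 ^ 2)) :=
      ((Real.continuous_exp.continuousAt.tendsto.comp (hw.lim.const_mul 2)).const_mul _).sub_const _
    rw [mul_zero, Real.exp_zero, mul_one, sub_self] at hlim
    refine squeeze_zero' (.of_forall fun x => by positivity) ?_ hlim
    filter_upwards [eventually_le_atBot x₀] with x hx using hle x hx
  rw [tendsto_zero_iff_norm_tendsto_zero]
  simpa [Real.sqrt_sq] using hsq.sqrt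

theorem tendsto_energy (hf : IsNormJost μ a b c d f) (hμ : μ.re ≤ 0)
    (hw : Dominates w W I a b c d) :
    Tendsto (fun x => ‖f x 0‖ ^ 2 + ‖f x 1‖ ^ 2) atBot (𝓝 1) := by
  simpa using (hf.lim_zero.norm.pow 2).add ((hf.tendsto_one hμ hw).norm.pow 2)

theorem energy_le (hf : IsNormJost μ a b c d f) (hμ : μ.re ≤ 0)
    (hw : Dominates w W I a b c d) (x : ℝ) :
    ‖f x 0‖ ^ 2 + ‖f x 1‖ ^ 2 ≤ Real.exp I ^ 2 := by
  have h1 : Tendsto (fun s => (‖f s 0‖ ^ 2 + ‖f s 1‖ ^ 2) * Real.exp (2 * I)) atBot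
      (𝓝 (1 * Real.exp (2 * I))) := (hf.tendsto_energy hμ hw).mul_const _
  rw [← Real.exp_nat_mul]
  rw [one_mul] at h1
  refine ge_of_tendsto h1 ?_
  filter_upwards [eventually_le_atBot x] with s hs
  refine (hf.sys.energy hμ hw hs).trans ?_
  gcongr
  exact hw.sub_le s x

theorem norm_le (hf : IsNormJost μ a b c d f) (hμ : μ.re ≤ 0)
    (hw : Dominates w W I a b c d) (x : ℝ) (i : Fin 2) : ‖f x i‖ ≤ Real.exp I := by
  have := hf.energy_le hμ hw x
  refine le_of_sq_le_sq ?_ (Real.exp_pos I).le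
  fin_cases i <;> simp only [Fin.zero_eta, Fin.mk_one] <;>
    nlinarith [sq_nonneg ‖f x 0‖, sq_nonneg ‖f x 1‖]

theorem norm_deriv_zero_le (hf : IsNormJost μ a b c d f) (hμ : μ.re ≤ 0)
    (hw : Dominates w W I a b c d) (x : ℝ) :
    ‖a x * f x 0 + b x * f x 1‖ ≤ Real.exp I * w x := by
  refine (norm_add_le _ _).trans ?_
  rw [norm_mul, norm_mul]
  have h1 := mul_le_mul_of_nonneg_left (hf.norm_le hμ hw x 0) (norm_nonneg (a x))
  have h2 := mul_le_mul_of_nonneg_left (hf.norm_le hμ hw x 1) (norm_nonneg (b x))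
  have h3 := mul_le_mul_of_nonneg_left (hw.le x) (Real.exp_pos I).le
  nlinarith [mul_nonneg (Real.exp_pos I).le (norm_nonneg (c x)),
    mul_nonneg (Real.exp_pos I).le (norm_nonneg (d x))]

theorem norm_sub_one_le (hf : IsNormJost μ a b c d f) (hμ : μ.re ≤ 0)
    (hw : Dominates w W I a b c d) (x : ℝ) : ‖f x 0 - 1‖ ≤ Real.exp I * W x := by
  have h1 : Tendsto (fun s => ‖f x 0 - f s 0‖) atBot (𝓝 ‖f x 0 - 1‖) :=
    (hf.lim_zero.const_sub _).norm
  refine le_of_tendsto h1 ?_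
  filter_upwards [eventually_le_atBot x] with s hs
  refine (norm_sub_le_of_norm_deriv_le hf.sys.deriv_zero hw.deriv hs
    fun τ _ => hf.norm_deriv_zero_le hμ hw τ).trans ?_
  gcongr
  linarith [hw.nonneg s]

/-- The energy of the difference tends to 0 at -∞ and grows at most by the factor e^{2I} afterwards.
-/
theorem unique (hf : IsNormJost μ a b c d f) (hg : IsNormJost μ a b c d g) (hμ : μ.re ≤ 0)
    (hw : Dominates w W I a b c d) : f = g := by
  have hlim : Tendsto (fun s => (‖f s 0 - g s 0‖ ^ 2 + ‖f s 1 - g s 1‖ ^ 2) * Real.exp (2 * I))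
      atBot (𝓝 0) := by
    simpa using ((((hf.lim_zero.sub hg.lim_zero).norm.pow 2).add
      (((hf.tendsto_one hμ hw).sub (hg.tendsto_one hμ hw)).norm.pow 2)).mul_const
      (Real.exp (2 * I)))
  funext x
  have hle : ‖f x 0 - g x 0‖ ^ 2 + ‖f x 1 - g x 1‖ ^ 2 ≤ 0 := by
    refine ge_of_tendsto hlim ?_
    filter_upwards [eventually_le_atBot x] with s hs
    refine ((hf.sys.sub hg.sys).energy hμ hw hs).trans ?_
    simp only [Pi.sub_apply]
    gcongr
    exact hw.sub_le s x
  have h0 : ‖f x 0 - g x 0‖ = 0 := by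
    nlinarith [sq_nonneg ‖f x 0 - g x 0‖, sq_nonneg ‖f x 1 - g x 1‖]
  have h1 : ‖f x 1 - g x 1‖ = 0 := by
    nlinarith [sq_nonneg ‖f x 0 - g x 0‖, sq_nonneg ‖f x 1 - g x 1‖]
  ext i
  fin_cases i
  · exact sub_eq_zero.1 (norm_eq_zero.1 h0)
  · exact sub_eq_zero.1 (norm_eq_zero.1 h1)

end IsNormJost

theorem cauchySeq_of_norm_sub_le {E : Type*} [NormedAddCommGroup E] {h : ℝ → E} {W : ℝ → ℝ}
    {C I : ℝ} (hC : 0 ≤ C) (hmono : Monotone W) (hI : ∀ x, W x ≤ I)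
    (hb : ∀ s x, s ≤ x → ‖h x - h s‖ ≤ C * (W x - W s)) : CauchySeq h := by
  have hlim := tendsto_atTop_ciSup hmono ⟨I, by rintro _ ⟨x, rfl⟩; exact hI x⟩
  refine cauchySeq_of_le_tendsto_0' (fun s => C * ((⨆ x, W x) - W s)) ?_ ?_
  · intro s x hsx
    rw [dist_comm, dist_eq_norm]
    have hle : W x ≤ ⨆ x, W x := le_ciSup (f := W) ⟨I, by rintro _ ⟨x, rfl⟩; exact hI x⟩ x
    exact (hb s x hsx).trans (by gcongr)
  · simpa using (hlim.const_sub (⨆ x, W x)).const_mul C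

end HalfLine

/-! ### The normalized system: existence and limits at the far end -/

section HalfLine

variable {μ : ℂ} {a b c d : ℝ → ℂ} {f g : ℝ → Fin 2 → ℂ} {w W : ℝ → ℝ} {I : ℝ}

theorem continuous_normMat (μ : ℂ) (ha : Continuous a) (hb : Continuous b) (hc : Continuous c)
    (hd : Continuous d) : Continuous (normMat μ a b c d) := by
  refine continuous_matrix fun i j => ?_
  fin_cases i <;> fin_cases j <;> simp [normMat] <;> fun_prop

/-- The solution is the limit, as s → -∞, of the solutions `m s` equal to (1, 0) at s. They stay
close to (1, 0) far to the left, uniformly in s, and the energy estimate carries this closeness to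
the right, so their values at 0 form a Cauchy sequence along s = -n. -/
theorem exists_isNormJost (ha : Continuous a) (hb : Continuous b) (hc : Continuous c)
    (hd : Continuous d) (hμ : μ.re ≤ 0) (hw : Dominates w W I a b c d) :
    ∃ f, IsNormJost μ a b c d f := by
  have hA : Continuous fun x => op (normMat μ a b c d x) :=
    continuous_op.comp (continuous_normMat μ ha hb hc hd)
  have hex : ∀ s, ∃ f : ℝ → Fin 2 → ℂ, f s = ![1, 0] ∧ NormSys μ a b c d f := fun s =>
    exists_linear_ode hA s ![1, 0]
  choose m hm0 hm using hex
  set C : ℝ := Real.exp I with hC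
  have hC0 : 0 < C := Real.exp_pos _
  have hC2 : Real.exp (2 * I) = C ^ 2 := by rw [hC, ← Real.exp_nat_mul]; norm_num
  -- The two summants bound |y - 1|², from integrating y', and |z|², from `norm_one_sq_le`. Only
  -- Q(τ) → 0 as τ → 0 matters.
  set Q : ℝ → ℝ := fun τ => C ^ 2 * (τ ^ 2 + (Real.exp (2 * τ) - 1)) with hQ
  have hnorm : ∀ s x, s ≤ x → ‖m s x 0‖ ^ 2 + ‖m s x 1‖ ^ 2 ≤ C ^ 2 := fun s x hsx => by
    refine ((hm s).energy hμ hw hsx).trans ?_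
    simp only [hm0, Matrix.cons_val_zero, Matrix.cons_val_one, norm_one, norm_zero, one_pow,
      ne_eq, OfNat.ofNat_ne_zero, not_false_eq_true, zero_pow, add_zero, one_mul]
    rw [← hC2]
    gcongr
    exact hw.sub_le s x
  have hnorm0 : ∀ s x, s ≤ x → ‖m s x 0‖ ≤ C := fun s x hsx =>
    le_of_sq_le_sq (by nlinarith [hnorm s x hsx, sq_nonneg ‖m s x 1‖]) hC0.le
  have hnorm1 : ∀ s x, s ≤ x → ‖m s x 1‖ ≤ C := fun s x hsx =>
    le_of_sq_le_sq (by nlinarith [hnorm s x hsx, sq_nonneg ‖m s x 0‖]) hC0.le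
  have hE : ∀ s x, s ≤ x → ‖m s x 0 - 1‖ ^ 2 + ‖m s x 1‖ ^ 2 ≤ Q (W x) := fun s x hsx => by
    have h0 : ‖m s x 0 - m s s 0‖ ≤ C * (W x - W s) :=
      norm_sub_le_of_norm_deriv_le (hm s).deriv_zero hw.deriv hsx fun τ hτ => by
        refine (norm_add_le _ _).trans ?_
        rw [norm_mul, norm_mul]
        have h1 := mul_le_mul_of_nonneg_left (hnorm0 s τ hτ.1) (norm_nonneg (a τ))
        have h2 := mul_le_mul_of_nonneg_left (hnorm1 s τ hτ.1) (norm_nonneg (b τ))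
        have h3 := mul_le_mul_of_nonneg_left (hw.le τ) hC0.le
        nlinarith [mul_nonneg hC0.le (norm_nonneg (c τ)), mul_nonneg hC0.le (norm_nonneg (d τ))]
    have h1 := (hm s).norm_one_sq_le hμ hw hsx (C := C) fun τ hτ => hnorm0 s τ hτ.1
    simp only [hm0, Matrix.cons_val_zero, Matrix.cons_val_one, mul_zero, norm_zero, ne_eq,
      OfNat.ofNat_ne_zero, not_false_eq_true, zero_pow, add_zero] at h0 h1
    have hWs := hw.nonneg s
    have hWsx : 0 ≤ W x - W s := sub_nonneg.2 (hw.mono hsx)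
    have h2 : ‖m s x 0 - 1‖ ^ 2 ≤ C ^ 2 * W x ^ 2 := by
      rw [← mul_pow]
      gcongr
      exact h0.trans (by gcongr; linarith)
    have h3 : Real.exp (2 * (W x - W s)) ≤ Real.exp (2 * W x) := by gcongr; linarith
    have h4 := mul_le_mul_of_nonneg_left h3 (sq_nonneg C)
    simp only [hQ]
    linarith
  have hdiff : ∀ s' s x, s' ≤ s → s ≤ x →
      ‖m s x 0 - m s' x 0‖ ^ 2 + ‖m s x 1 - m s' x 1‖ ^ 2 ≤ Q (W s) * C ^ 2 := by
    intro s' s x hs' hs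
    have h1 := ((hm s').sub (hm s)).energy hμ hw hs
    simp only [Pi.sub_apply] at h1
    rw [norm_sub_rev (m s x 0), norm_sub_rev (m s x 1)]
    refine h1.trans ?_
    have h2 := hE s' s hs'
    have h3 : Real.exp (2 * (W x - W s)) ≤ C ^ 2 := by
      rw [← hC2]
      gcongr
      exact hw.sub_le s x
    refine mul_le_mul ?_ h3 (Real.exp_pos _).le ((by positivity : (0 : ℝ) ≤ _).trans h2)
    simpa [hm0] using h2
  have hQlim : Tendsto (fun x => Q (W x)) atBot (𝓝 0) := by
    have : Tendsto Q (𝓝 0) (𝓝 (Q 0)) := (by fun_prop : Continuous Q).continuousAt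
    have h0 : Q 0 = 0 := by simp [hQ]
    rw [h0] at this
    exact this.comp hw.lim
  have hneg : Tendsto (fun n : ℕ => -(n : ℝ)) atTop atBot :=
    tendsto_neg_atTop_atBot.comp tendsto_natCast_atTop_atTop
  have hcauchy : CauchySeq fun n : ℕ => m (-(n : ℝ)) 0 := by
    refine cauchySeq_of_le_tendsto_0' (fun n : ℕ => √(Q (W (-(n : ℝ))) * C ^ 2)) ?_ ?_
    · intro n k hnk
      rw [dist_eq_norm, pi_norm_le_iff_of_nonneg (Real.sqrt_nonneg _)]
      have h1 := hdiff (-(k : ℝ)) (-(n : ℝ)) 0 (by simpa using hnk) (by simp)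
      intro i
      refine Real.le_sqrt_of_sq_le (le_trans ?_ h1)
      fin_cases i <;> simp only [Fin.zero_eta, Fin.mk_one, Pi.sub_apply] <;>
        linarith [sq_nonneg ‖m (-(n : ℝ)) 0 0 - m (-(k : ℝ)) 0 0‖,
          sq_nonneg ‖m (-(n : ℝ)) 0 1 - m (-(k : ℝ)) 0 1‖]
    · simpa using ((hQlim.comp hneg).mul_const (C ^ 2)).sqrt
  obtain ⟨v, hv⟩ := cauchySeq_tendsto_of_complete hcauchy
  obtain ⟨f, hf0, hf⟩ := exists_linear_ode hA 0 v
  have hfs : NormSys μ a b c d f := hf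
  -- Convergence at 0 spreads to every x by continuous dependence on the initial value.
  have hpt : ∀ x, Tendsto (fun n : ℕ => m (-(n : ℝ)) x) atTop (𝓝 (f x)) := fun x => by
    obtain ⟨K, hK⟩ := (isCompact_uIcc (a := (0 : ℝ)) (b := x)).exists_bound_of_continuousOn
      hA.continuousOn
    rw [tendsto_iff_norm_sub_tendsto_zero] at hv ⊢
    have h1 : Tendsto (fun n : ℕ => ‖m (-(n : ℝ)) 0 - v‖ * Real.exp (K * |x - 0|)) atTop (𝓝 0) := by
      simpa using hv.mul_const (Real.exp (K * |x - 0|))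
    refine squeeze_zero (fun n => norm_nonneg _) (fun n => ?_) h1
    have := norm_le_exp_of_linear_ode ((hm (-(n : ℝ))).sub hfs) hK
    rwa [hf0] at this
  have hEf : ∀ x, ‖f x 0 - 1‖ ^ 2 + ‖f x 1‖ ^ 2 ≤ Q (W x) := fun x => by
    have h0 := tendsto_pi_nhds.1 (hpt x)
    refine le_of_tendsto ((((h0 0).sub_const 1).norm.pow 2).add ((h0 1).norm.pow 2)) ?_
    filter_upwards [hneg.eventually_le_atBot x] with n hn using hE _ x hn
  have hsqrt : Tendsto (fun x => √(Q (W x))) atBot (𝓝 0) := by simpa using hQlim.sqrt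
  refine ⟨f, hfs, ?_, ?_⟩
  · rw [tendsto_iff_norm_sub_tendsto_zero]
    exact squeeze_zero (fun x => norm_nonneg _)
      (fun x => Real.le_sqrt_of_sq_le (by linarith [hEf x, sq_nonneg ‖f x 1‖])) hsqrt
  · refine squeeze_zero_norm' ?_ hsqrt
    filter_upwards [eventually_le_atBot (0 : ℝ)] with x hx
    rw [norm_mul]
    have h1 : ‖f x 1‖ ≤ √(Q (W x)) :=
      Real.le_sqrt_of_sq_le (by linarith [hEf x, sq_nonneg ‖f x 0 - 1‖])
    refine (mul_le_of_le_one_left (norm_nonneg _) ?_).trans h1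
    rw [Complex.norm_exp, Real.exp_le_one_iff, Complex.re_mul_ofReal]
    have : (-μ / 2).re = -μ.re / 2 := by simp
    rw [this]
    exact mul_nonpos_of_nonneg_of_nonpos (by linarith) hx

namespace IsNormJost

theorem exists_tendsto_zero (hf : IsNormJost μ a b c d f) (hμ : μ.re ≤ 0)
    (hw : Dominates w W I a b c d) : ∃ l, Tendsto (fun x => f x 0) atTop (𝓝 l) :=
  cauchySeq_tendsto_of_complete <| cauchySeq_of_norm_sub_le (Real.exp_pos I).le hw.mono hw.bound
    fun _ _ hsx => norm_sub_le_of_norm_deriv_le hf.sys.deriv_zero hw.deriv hsx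
      fun τ _ => hf.norm_deriv_zero_le hμ hw τ

/-- For imaginary μ the factor e^{-μx} has modulus 1, so the derivative of e^{-μx}z is dominated by
a multiple of w. -/
theorem exists_tendsto_one (hf : IsNormJost μ a b c d f) (hμ : μ.re = 0)
    (hw : Dominates w W I a b c d) :
    ∃ l, Tendsto (fun x : ℝ => Complex.exp (-μ * x) * f x 1) atTop (𝓝 l) := by
  have hder : ∀ x : ℝ, HasDerivAt (fun x : ℝ => Complex.exp (-μ * x) * f x 1)
      (Complex.exp (-μ * x) * (c x * f x 0 + d x * f x 1)) x := fun x => by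
    have h1 : HasDerivAt (fun x : ℝ => Complex.exp (-μ * x))
        (Complex.exp (-μ * x) * (-μ * 1)) x :=
      ((Complex.ofRealCLM.hasDerivAt (x := x)).const_mul (-μ)).cexp
    refine (h1.fun_mul (hf.sys.deriv_one x)).congr_deriv ?_
    ring
  refine cauchySeq_tendsto_of_complete <| cauchySeq_of_norm_sub_le (Real.exp_pos I).le hw.mono
    hw.bound fun _ _ hsx => norm_sub_le_of_norm_deriv_le hder hw.deriv hsx fun x _ => ?_
  have h1 : ‖Complex.exp (-μ * x)‖ = 1 := by
    rw [Complex.norm_exp, Complex.re_mul_ofReal, Complex.neg_re, hμ]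
    simp
  rw [norm_mul, h1, one_mul]
  refine (norm_add_le _ _).trans ?_
  rw [norm_mul, norm_mul]
  have h1 := mul_le_mul_of_nonneg_left (hf.norm_le hμ.le hw x 0) (norm_nonneg (c x))
  have h2 := mul_le_mul_of_nonneg_left (hf.norm_le hμ.le hw x 1) (norm_nonneg (d x))
  have h3 := mul_le_mul_of_nonneg_left (hw.le x) (Real.exp_pos I).le
  nlinarith [mul_nonneg (Real.exp_pos I).le (norm_nonneg (a x)),
    mul_nonneg (Real.exp_pos I).le (norm_nonneg (b x))]

end IsNormJost

end HalfLine

/-! ### The four Jost solutions as one normalized problem -/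

section Jost

/-- The sign `s_i`: the `i`-th component of a free solution is `e^{-i s_i ζ² x}`. -/
def sgn : Fin 2 → ℝ := ![1, -1]

theorem sgn_compl (i : Fin 2) : sgn (1 - i) = -sgn i := by fin_cases i <;> simp [sgn]

theorem compl_compl (i : Fin 2) : 1 - (1 - i) = i := by fin_cases i <;> rfl

theorem eq_or_eq_compl (i k : Fin 2) : k = i ∨ k = 1 - i := by
  fin_cases i <;> fin_cases k <;> simp

theorem compl_ne (i : Fin 2) : 1 - i ≠ i := by fin_cases i <;> simp

/-- The weight `e^{i s_i ζ² x}` that normalizes the `i`-th component. -/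
noncomputable def wt (i : Fin 2) (ζ : ℂ) (x : ℝ) : ℂ := Complex.exp (Complex.I * sgn i * ζ ^ 2 * x)

theorem wt_zero : wt 0 = ePlus := by funext ζ x; simp [wt, sgn, ePlus]

theorem wt_one : wt 1 = eMinus := by funext ζ x; simp [wt, sgn, eMinus]

theorem wt_ne_zero (i : Fin 2) (ζ : ℂ) (x : ℝ) : wt i ζ x ≠ 0 := Complex.exp_ne_zero _

theorem hasDerivAt_wt (i : Fin 2) (ζ : ℂ) (δ x : ℝ) :
    HasDerivAt (fun x : ℝ => wt i ζ (δ * x)) (Complex.I * sgn i * ζ ^ 2 * δ * wt i ζ (δ * x)) x := by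
  have h : HasDerivAt (fun x : ℝ => ((δ * x : ℝ) : ℂ)) (δ : ℂ) x := by
    simpa using (((hasDerivAt_id x).const_mul δ).ofReal_comp)
  refine (h.const_mul (Complex.I * sgn i * ζ ^ 2)).cexp.congr_deriv ?_
  simp only [wt]
  ring

/-- The part of the `i`-th diagonal entry of `𝒳` that depends on the potentials. -/
noncomputable def diagCoeff (q r : ℝ → ℂ) (i : Fin 2) (x : ℝ) : ℂ :=
  ![0, Complex.I / 2 * q x * r x] i

/-- The off-diagonal entry in the `i`-th row of `𝒳`. -/
def offCoeff (q r : ℝ → ℂ) (ζ : ℂ) (i : Fin 2) (x : ℝ) : ℂ := ζ * ![q x, r x] i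

theorem isSolution_iff {q r : ℝ → ℂ} {ζ : ℂ} {f : ℝ → Fin 2 → ℂ} :
    IsSolution q r ζ f ↔ ∀ i x, HasDerivAt (fun x => f x i)
      (-(Complex.I * sgn i * ζ ^ 2) * f x i + diagCoeff q r i x * f x i
        + offCoeff q r ζ i x * f x (1 - i)) x := by
  have h : ∀ x i, (matX ζ (q x) (r x)).mulVec (f x) i
      = -(Complex.I * sgn i * ζ ^ 2) * f x i + diagCoeff q r i x * f x i
        + offCoeff q r ζ i x * f x (1 - i) := fun x i => by
    fin_cases i
    · simp [matX, Matrix.mulVec, dotProduct, Fin.sum_univ_two, diagCoeff, offCoeff, sgn]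
    · simp [matX, Matrix.mulVec, dotProduct, Fin.sum_univ_two, diagCoeff, offCoeff, sgn]
      ring
  simp only [IsSolution, hasDerivAt_pi, h]
  exact forall_comm

/-- The end of the line (`-∞` for `δ = 1`, `+∞` for `δ = -1`) at which a Jost solution is
normalized. -/
def startFilter (δ : ℝ) : Filter ℝ := map (fun x => δ * x) atBot

/-- The end of the line opposite to `startFilter δ`. -/
def endFilter (δ : ℝ) : Filter ℝ := map (fun x => δ * x) atTop

/-- The Jost solution with dominant component `i`, normalized at the end `startFilter δ`. -/
def IsJost (i : Fin 2) (δ : ℝ) (q r : ℝ → ℂ) (ζ : ℂ) (f : ℝ → Fin 2 → ℂ) : Prop :=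
  IsSolution q r ζ f ∧ Tendsto (fun x => wt i ζ x * f x i) (startFilter δ) (𝓝 1) ∧
    Tendsto (fun x => f x (1 - i)) (startFilter δ) (𝓝 0)

theorem startFilter_one : startFilter 1 = atBot := by simp [startFilter]

theorem endFilter_one : endFilter 1 = atTop := by simp [endFilter]

theorem startFilter_neg_one : startFilter (-1) = atTop := by
  simp only [startFilter, neg_mul, one_mul]
  exact (map_neg_atBot (G := ℝ))

theorem endFilter_neg_one : endFilter (-1) = atBot := by
  simp only [endFilter, neg_mul, one_mul]
  exact (map_neg_atTop (G := ℝ))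

theorem isJostPhi_eq : IsJostPhi = IsJost 0 1 := by
  funext q r ζ f
  simp [IsJostPhi, IsJost, startFilter_one, wt_zero]

theorem isJostPhiBar_eq : IsJostPhiBar = IsJost 1 1 := by
  funext q r ζ f
  simp [IsJostPhiBar, IsJost, startFilter_one, wt_one, and_comm]

theorem isJostPsi_eq : IsJostPsi = IsJost 1 (-1) := by
  funext q r ζ f
  simp [IsJostPsi, IsJost, startFilter_neg_one, wt_one, and_comm]

theorem isJostPsiBar_eq : IsJostPsiBar = IsJost 0 (-1) := by
  funext q r ζ f
  simp [IsJostPsiBar, IsJost, startFilter_neg_one, wt_zero]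

/-- A solution, reflected and rescaled so that a Jost solution becomes an `IsNormJost`. -/
noncomputable def normalized (i : Fin 2) (δ : ℝ) (ζ : ℂ) (f : ℝ → Fin 2 → ℂ) (x : ℝ) : Fin 2 → ℂ :=
  ![wt i ζ (δ * x) * f (δ * x) i, wt i ζ (δ * x) * f (δ * x) (1 - i)]

/-- The coefficient `μ` of the normalized system. -/
noncomputable def rate (i : Fin 2) (δ : ℝ) (ζ : ℂ) : ℂ := 2 * Complex.I * δ * sgn i * ζ ^ 2

theorem rate_re (i : Fin 2) (δ : ℝ) (ζ : ℂ) : (rate i δ ζ).re = -2 * (δ * sgn i * (ζ ^ 2).im) := by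
  have : rate i δ ζ = ((2 * δ * sgn i : ℝ) : ℂ) * (Complex.I * ζ ^ 2) := by
    simp only [rate]; push_cast; ring
  rw [this, Complex.re_ofReal_mul, Complex.I_mul_re]
  ring

/-- The property of being the normalized form of the Jost solution of kind `(i, δ)`. -/
def IsNormalizedJost (i : Fin 2) (δ : ℝ) (q r : ℝ → ℂ) (ζ : ℂ) (F : ℝ → Fin 2 → ℂ) : Prop :=
  IsNormJost (rate i δ ζ) (fun x => δ * diagCoeff q r i (δ * x))
    (fun x => δ * offCoeff q r ζ i (δ * x)) (fun x => δ * offCoeff q r ζ (1 - i) (δ * x))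
    (fun x => δ * diagCoeff q r (1 - i) (δ * x)) F

/-- This identity makes the second limit in `IsNormJost` the same as the unweighted condition that
the component 1 - i of the Jost solution tends to 0. -/
theorem exp_mul_wt (i : Fin 2) (δ : ℝ) (ζ : ℂ) (x : ℝ) :
    Complex.exp (-rate i δ ζ / 2 * x) * wt i ζ (δ * x) = 1 := by
  rw [wt, ← Complex.exp_add, Complex.exp_eq_one_iff]
  refine ⟨0, ?_⟩
  simp only [rate]
  push_cast
  ring

theorem exp_mul_wt' (i : Fin 2) (δ : ℝ) (ζ : ℂ) (x : ℝ) :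
    Complex.exp (-rate i δ ζ * x) * wt i ζ (δ * x) = wt (1 - i) ζ (δ * x) := by
  rw [wt, wt, ← Complex.exp_add, sgn_compl]
  simp only [rate]
  push_cast
  ring_nf

theorem hasDerivAt_comp_const_mul {h : ℝ → ℂ} {h' : ℂ} {δ x : ℝ} (hh : HasDerivAt h h' (δ * x)) :
    HasDerivAt (fun x => h (δ * x)) (δ * h') x := by
  have := hh.scomp x ((hasDerivAt_id x).const_mul δ)
  simpa [Function.comp_def] using this

variable {i : Fin 2} {δ : ℝ} {q r : ℝ → ℂ} {ζ : ℂ} {f : ℝ → Fin 2 → ℂ}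

theorem IsJost.normalize (hf : IsJost i δ q r ζ f) :
    IsNormalizedJost i δ q r ζ (normalized i δ ζ f) := by
  have hs := isSolution_iff.1 hf.1
  refine ⟨fun x => hasDerivAt_pi.2 (Fin.forall_fin_two.2 ⟨?_, ?_⟩), ?_, ?_⟩
  · refine ((hasDerivAt_wt i ζ δ x).fun_mul (hasDerivAt_comp_const_mul (hs i (δ * x)))).congr_deriv ?_
    simp [op_apply, normMat, normalized, Matrix.mulVec, dotProduct, Fin.sum_univ_two]
    ring
  · refine ((hasDerivAt_wt i ζ δ x).fun_mul
      (hasDerivAt_comp_const_mul (hs (1 - i) (δ * x)))).congr_deriv ?_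
    simp [op_apply, normMat, normalized, Matrix.mulVec, dotProduct, Fin.sum_univ_two,
      rate, sgn_compl]
    ring
  · exact tendsto_map'_iff.1 hf.2.1
  · refine (tendsto_map'_iff.1 hf.2.2).congr fun x => ?_
    simp [normalized, ← mul_assoc, exp_mul_wt]

theorem exists_isJost_of_normalized (hδ : δ * δ = 1) {F : ℝ → Fin 2 → ℂ}
    (hF : IsNormalizedJost i δ q r ζ F) : ∃ f, IsJost i δ q r ζ f := by
  have hδx : ∀ x : ℝ, δ * (δ * x) = x := fun x => by rw [← mul_assoc, hδ, one_mul]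
  have hδc : (δ : ℂ) * δ = 1 := by exact_mod_cast hδ
  have hδc' : ∀ z : ℂ, δ * (δ * z) = z := fun z => by rw [← mul_assoc, hδc, one_mul]
  have hwt : ∀ x : ℝ, HasDerivAt (fun x : ℝ => (wt i ζ x)⁻¹)
      (-(Complex.I * sgn i * ζ ^ 2) * (wt i ζ x)⁻¹) x := fun x => by
    have h1 := hasDerivAt_wt i ζ 1 x
    simp only [one_mul, Complex.ofReal_one, mul_one] at h1
    refine (h1.fun_inv (wt_ne_zero i ζ x)).congr_deriv ?_
    field_simp [wt_ne_zero i ζ x]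
  let f : ℝ → Fin 2 → ℂ := fun x k => (wt i ζ x)⁻¹ * F (δ * x) (if k = i then 0 else 1)
  have hfi : ∀ x, f x i = (wt i ζ x)⁻¹ * F (δ * x) 0 := fun x => by simp [f]
  have hfc : ∀ x, f x (1 - i) = (wt i ζ x)⁻¹ * F (δ * x) 1 := fun x => by simp [f, compl_ne]
  refine ⟨f, isSolution_iff.2 fun k x => ?_, ?_, ?_⟩
  · rcases eq_or_eq_compl i k with rfl | rfl
    · simp only [hfi, hfc]
      refine ((hwt x).fun_mul
        (hasDerivAt_comp_const_mul (hF.sys.deriv_zero (δ * x)))).congr_deriv ?_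
      simp only [hδx]
      linear_combination (wt k ζ x)⁻¹ * (diagCoeff q r k x * F (δ * x) 0
        + offCoeff q r ζ k x * F (δ * x) 1) * hδc
    · simp only [hfi, hfc, compl_compl, sgn_compl]
      refine ((hwt x).fun_mul
        (hasDerivAt_comp_const_mul (hF.sys.deriv_one (δ * x)))).congr_deriv ?_
      simp only [hδx, rate]
      push_cast
      linear_combination (wt i ζ x)⁻¹ * (2 * Complex.I * sgn i * ζ ^ 2 * F (δ * x) 1
        + diagCoeff q r (1 - i) x * F (δ * x) 1 + offCoeff q r ζ (1 - i) x * F (δ * x) 0) * hδc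
  · refine tendsto_map'_iff.2 (hF.lim_zero.congr fun x => ?_)
    simp [hfi, wt_ne_zero, hδx]
  · refine tendsto_map'_iff.2 (hF.lim_one.congr fun x => ?_)
    simp only [Function.comp_apply, hfc, hδx]
    rw [← eq_inv_of_mul_eq_one_left (exp_mul_wt i δ ζ x)]

end Jost

/-! ### Jost solutions for Schwartz potentials -/

section Schwartz

variable (q r : 𝓢(ℝ, ℂ)) (δ : ℝ)

/-- The integrable function that dominates the coefficients for `‖ζ‖ ≤ Z`. -/
noncomputable def domDensity (Z : ℝ) (x : ℝ) : ℝ :=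
  2 * (1 + Z) * (‖q (δ * x)‖ + ‖r (δ * x)‖ + ‖q (δ * x)‖ * ‖r (δ * x)‖)

/-- The primitive of `domDensity` that vanishes at `-∞`. -/
noncomputable def domPrimitive (Z : ℝ) (x : ℝ) : ℝ := ∫ y in Set.Iic x, domDensity q r δ Z y

theorem continuous_domDensity (Z : ℝ) : Continuous (domDensity q r δ Z) := by
  have := q.continuous
  have := r.continuous
  unfold domDensity
  fun_prop

theorem integrable_domDensity (hδ : δ * δ = 1) (Z : ℝ) :
    MeasureTheory.Integrable (domDensity q r δ Z) := by
  have hδ0 : δ ≠ 0 := by rintro rfl; simp at hδ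
  have hq := (q.integrable (μ := MeasureTheory.volume)).norm
  have hr := (r.integrable (μ := MeasureTheory.volume)).norm
  obtain ⟨C, hC⟩ : ∃ C, ∀ x, ‖‖q x‖‖ ≤ C :=
    ⟨_, fun x => by simpa using q.norm_le_seminorm ℝ x⟩
  have hqr : MeasureTheory.Integrable (fun x => ‖q x‖ * ‖r x‖) :=
    hr.bdd_mul q.continuous.norm.aestronglyMeasurable (.of_forall hC)
  exact (((hq.add hr).add hqr).comp_mul_left' hδ0).const_mul (2 * (1 + Z))

/-- The dominating function depends on ζ only through Z; all bounds that are uniform near a pole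
rest on this. -/
theorem dominates (hδ : δ * δ = 1) (i : Fin 2) {Z : ℝ} {ζ : ℂ} (hζ : ‖ζ‖ ≤ Z) :
    Dominates (domDensity q r δ Z) (domPrimitive q r δ Z) (∫ y, domDensity q r δ Z y)
      (fun x => δ * diagCoeff q r i (δ * x)) (fun x => δ * offCoeff q r ζ i (δ * x))
      (fun x => δ * offCoeff q r ζ (1 - i) (δ * x))
      (fun x => δ * diagCoeff q r (1 - i) (δ * x)) where
  le x := by
    have hδ1 : ‖(δ : ℂ)‖ = 1 := by
      rw [Complex.norm_real, Real.norm_eq_abs]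
      rcases mul_self_eq_one_iff.1 hδ with h | h <;> simp [h]
    have hZ : 0 ≤ Z := (norm_nonneg ζ).trans hζ
    have h1 := mul_le_mul_of_nonneg_right hζ (norm_nonneg (q (δ * x)))
    have h2 := mul_le_mul_of_nonneg_right hζ (norm_nonneg (r (δ * x)))
    have h3 : 0 ≤ ‖q (δ * x)‖ * ‖r (δ * x)‖ := by positivity
    have h4 := mul_nonneg hZ h3
    have h5 := mul_nonneg hZ (norm_nonneg (q (δ * x)))
    have h6 := mul_nonneg hZ (norm_nonneg (r (δ * x)))
    simp only [norm_mul, hδ1, one_mul, domDensity]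
    fin_cases i <;> simp [diagCoeff, offCoeff] <;>
      linarith [norm_nonneg (q (δ * x)), norm_nonneg (r (δ * x))]
  deriv x := by
    have hi := integrable_domDensity q r δ hδ Z
    have hc := continuous_domDensity q r δ Z
    have h1 : domPrimitive q r δ Z = fun x =>
        (∫ y in Set.Iic 0, domDensity q r δ Z y) + ∫ y in (0 : ℝ)..x, domDensity q r δ Z y := by
      funext x
      rw [← intervalIntegral.integral_Iic_sub_Iic hi.integrableOn hi.integrableOn, domPrimitive]
      ring
    rw [h1]
    exact (intervalIntegral.integral_hasDerivAt_right (hc.intervalIntegrable _ _)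
      (hc.stronglyMeasurableAtFilter _ _) hc.continuousAt).const_add _
  lim := MeasureTheory.tendsto_integral_Iic_zero tendsto_id
  bound x := by
    refine MeasureTheory.setIntegral_le_integral (integrable_domDensity q r δ hδ Z)
      (.of_forall fun y => ?_)
    have hZ : 0 ≤ Z := (norm_nonneg ζ).trans hζ
    simp only [domDensity, Pi.zero_apply]
    positivity

variable {q r δ} {i : Fin 2} {ζ : ℂ} {f g : ℝ → Fin 2 → ℂ}

theorem rate_re_nonpos (h : 0 ≤ δ * sgn i * (ζ ^ 2).im) : (rate i δ ζ).re ≤ 0 := by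
  rw [rate_re]; linarith

theorem exists_isJost (hδ : δ * δ = 1) (h : 0 ≤ δ * sgn i * (ζ ^ 2).im) :
    ∃ f, IsJost i δ q r ζ f := by
  have hq := q.continuous
  have hr := r.continuous
  have h1 : ∀ i, Continuous fun x : ℝ => (δ : ℂ) * diagCoeff q r i (δ * x) := fun i => by
    fin_cases i <;> simp [diagCoeff] <;> fun_prop
  have h2 : ∀ i, Continuous fun x : ℝ => (δ : ℂ) * offCoeff q r ζ i (δ * x) := fun i => by
    fin_cases i <;> simp [offCoeff] <;> fun_prop
  obtain ⟨F, hF⟩ := exists_isNormJost (h1 i) (h2 i) (h2 (1 - i)) (h1 (1 - i))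
    (rate_re_nonpos h) (dominates q r δ hδ i le_rfl)
  exact exists_isJost_of_normalized hδ hF

theorem IsJost.unique (hδ : δ * δ = 1) (h : 0 ≤ δ * sgn i * (ζ ^ 2).im)
    (hf : IsJost i δ q r ζ f) (hg : IsJost i δ q r ζ g) : f = g := by
  have := hf.normalize.unique hg.normalize (rate_re_nonpos h) (dominates q r δ hδ i le_rfl)
  funext x k
  have hx := congrFun this (δ * x)
  have hδx : δ * (δ * x) = x := by rw [← mul_assoc, hδ, one_mul]
  have h0 := congrFun hx 0
  have h1 := congrFun hx 1
  simp only [normalized, hδx, Matrix.cons_val_zero, Matrix.cons_val_one,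
    mul_right_inj' (wt_ne_zero i ζ x)] at h0 h1
  rcases eq_or_eq_compl i k with rfl | rfl
  · exact h0
  · exact h1

theorem isJost_theFun (hδ : δ * δ = 1) (h : 0 ≤ δ * sgn i * (ζ ^ 2).im) :
    IsJost i δ q r ζ (theFun (IsJost i δ q r ζ)) := by
  have hex : ∃ f, IsJost i δ q r ζ f := exists_isJost hδ h
  rw [theFun, dif_pos hex]
  exact hex.choose_spec

theorem IsJost.eq_theFun (hδ : δ * δ = 1) (h : 0 ≤ δ * sgn i * (ζ ^ 2).im)
    (hf : IsJost i δ q r ζ f) : theFun (IsJost i δ q r ζ) = f :=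
  (isJost_theFun hδ h).unique hδ h hf

/-- Stronger than the defining condition, because the weight has modulus at least 1 near the
normalizing end. -/
theorem IsJost.tendsto_compl (hδ : δ * δ = 1) (h : 0 ≤ δ * sgn i * (ζ ^ 2).im)
    (hf : IsJost i δ q r ζ f) :
    Tendsto (fun x => wt i ζ x * f x (1 - i)) (startFilter δ) (𝓝 0) :=
  tendsto_map'_iff.2 (hf.normalize.tendsto_one (rate_re_nonpos h) (dominates q r δ hδ i le_rfl))

theorem IsJost.exists_tendsto (hδ : δ * δ = 1) (h : 0 ≤ δ * sgn i * (ζ ^ 2).im)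
    (hf : IsJost i δ q r ζ f) :
    ∃ l, Tendsto (fun x => wt i ζ x * f x i) (endFilter δ) (𝓝 l) := by
  obtain ⟨l, hl⟩ := hf.normalize.exists_tendsto_zero (rate_re_nonpos h)
    (dominates q r δ hδ i le_rfl)
  exact ⟨l, tendsto_map'_iff.2 hl⟩

theorem IsJost.exists_tendsto_compl (hδ : δ * δ = 1) (h : (ζ ^ 2).im = 0)
    (hf : IsJost i δ q r ζ f) :
    ∃ l, Tendsto (fun x => wt (1 - i) ζ x * f x (1 - i)) (endFilter δ) (𝓝 l) := by
  obtain ⟨l, hl⟩ := hf.normalize.exists_tendsto_one (by rw [rate_re, h]; simp)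
    (dominates q r δ hδ i le_rfl)
  refine ⟨l, tendsto_map'_iff.2 (hl.congr fun x => ?_)⟩
  simp [normalized, ← mul_assoc, ← exp_mul_wt']

theorem IsJost.exists_bound (hδ : δ * δ = 1) (Z : ℝ) :
    ∃ C, ∀ (ζ : ℂ) (f : ℝ → Fin 2 → ℂ), ‖ζ‖ ≤ Z → 0 ≤ δ * sgn i * (ζ ^ 2).im →
      IsJost i δ q r ζ f → ∀ x k, ‖wt i ζ x * f x k‖ ≤ C := by
  refine ⟨Real.exp (∫ y, domDensity q r δ Z y), fun ζ f hζ h hf x k => ?_⟩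
  have hb := hf.normalize.norm_le (rate_re_nonpos h) (dominates q r δ hδ i hζ) (δ * x)
  have hδx : δ * (δ * x) = x := by rw [← mul_assoc, hδ, one_mul]
  have h0 := hb 0
  have h1 := hb 1
  simp only [normalized, hδx, Matrix.cons_val_zero, Matrix.cons_val_one] at h0 h1
  rcases eq_or_eq_compl i k with rfl | rfl
  · exact h0
  · exact h1

/-- Far enough towards the normalizing end the weighted dominant component is within 1/2 of 1, at
one point x that serves all ζ with ‖ζ‖ ≤ Z. -/
theorem IsJost.exists_lower_bound (hδ : δ * δ = 1) {Z : ℝ} (hZ : 0 ≤ Z) :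
    ∃ x, ∀ (ζ : ℂ) (f : ℝ → Fin 2 → ℂ), ‖ζ‖ ≤ Z → 0 ≤ δ * sgn i * (ζ ^ 2).im →
      IsJost i δ q r ζ f → 1 / 2 ≤ ‖wt i ζ x * f x i‖ := by
  have hlim := ((dominates q r δ hδ i (ζ := 0) (by simpa using hZ)).lim.const_mul
    (Real.exp (∫ y, domDensity q r δ Z y)))
  rw [mul_zero] at hlim
  obtain ⟨x, hx⟩ := (hlim.eventually (gt_mem_nhds (by norm_num : (0 : ℝ) < 1 / 2))).exists
  refine ⟨δ * x, fun ζ f hζ h hf => ?_⟩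
  have hb := hf.normalize.norm_sub_one_le (rate_re_nonpos h) (dominates q r δ hδ i hζ) x
  have h0 : normalized i δ ζ f x 0 = wt i ζ (δ * x) * f (δ * x) i := rfl
  rw [h0] at hb
  have h2 := norm_sub_norm_le (1 : ℂ) (wt i ζ (δ * x) * f (δ * x) i)
  rw [norm_one, norm_sub_rev] at h2
  linarith

end Schwartz

/-! ### The time evolution by 𝒯 and its behaviour at infinity -/

section Evolution

/-- The `x`-derivative of `𝒯`, in terms of the potentials and their first two derivatives. -/
noncomputable def matTDeriv (ζ q r q₁ r₁ q₂ r₂ : ℂ) : Matrix (Fin 2) (Fin 2) ℂ :=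
  !![-Complex.I * ζ ^ 2 * (q₁ * r + q * r₁),
       2 * ζ ^ 3 * q₁ + ζ * (Complex.I * q₂ + 1 / 2 * (2 * q * q₁ * r + q ^ 2 * r₁));
     2 * ζ ^ 3 * r₁ + ζ * (-Complex.I * r₂ + 1 / 2 * (q₁ * r ^ 2 + 2 * q * r * r₁)),
       Complex.I * ζ ^ 2 * (q₁ * r + q * r₁) + 1 / 2 * (q * r₂ - q₂ * r)
         + Complex.I / 4 * (2 * q * q₁ * r ^ 2 + 2 * q ^ 2 * r * r₁)]

/-- The derivative of a Schwartz function. -/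
noncomputable abbrev sderiv (f : 𝓢(ℝ, ℂ)) : 𝓢(ℝ, ℂ) := SchwartzMap.derivCLM ℝ ℂ f

theorem hasDerivAt_sderiv (f : 𝓢(ℝ, ℂ)) (x : ℝ) : HasDerivAt f (sderiv f x) x :=
  f.hasDerivAt x

theorem matTAt_eq (ζ : ℂ) (q r : 𝓢(ℝ, ℂ)) (x : ℝ) :
    matTAt ζ q r x = matT ζ (q x) (r x) (sderiv q x) (sderiv r x) := rfl

theorem hasDerivAt_matTAt (ζ : ℂ) (q r : 𝓢(ℝ, ℂ)) (x : ℝ) (i j : Fin 2) :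
    HasDerivAt (fun y => matTAt ζ q r y i j)
      (matTDeriv ζ (q x) (r x) (sderiv q x) (sderiv r x) (sderiv (sderiv q) x)
        (sderiv (sderiv r) x) i j) x := by
  have hq := hasDerivAt_sderiv q x
  have hr := hasDerivAt_sderiv r x
  have hq₁ := hasDerivAt_sderiv (sderiv q) x
  have hr₁ := hasDerivAt_sderiv (sderiv r) x
  simp only [matTAt_eq]
  fin_cases i <;> fin_cases j
  · refine (((hq.const_mul (Complex.I * ζ ^ 2)).fun_mul hr).const_sub _).congr_deriv ?_
    simp [matTDeriv]
    ring
  · refine ((hq.const_mul (2 * ζ ^ 3)).fun_add (((hq₁.const_mul Complex.I).fun_add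
      (((hq.fun_pow 2).const_mul (1 / 2)).fun_mul hr)).const_mul ζ)).congr_deriv ?_
    simp only [matTDeriv, Fin.zero_eta, Fin.mk_one, Matrix.of_apply, Matrix.cons_val_zero,
      Matrix.cons_val_one, Nat.cast_ofNat, Nat.add_one_sub_one]
    ring
  · refine ((hr.const_mul (2 * ζ ^ 3)).fun_add (((hr₁.const_mul (-Complex.I)).fun_add
      ((hq.const_mul (1 / 2)).fun_mul (hr.fun_pow 2))).const_mul ζ)).congr_deriv ?_
    simp only [matTDeriv, Fin.zero_eta, Fin.mk_one, Matrix.of_apply, Matrix.cons_val_zero,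
      Matrix.cons_val_one, Nat.cast_ofNat, Nat.add_one_sub_one]
    ring
  · refine (((((hq.const_mul (Complex.I * ζ ^ 2)).fun_mul hr).const_add
      (2 * Complex.I * ζ ^ 4)).fun_add (((hq.fun_mul hr₁).fun_sub (hq₁.fun_mul hr)).const_mul
      (1 / 2))).fun_add (((hq.fun_pow 2).const_mul (Complex.I / 4)).fun_mul
      (hr.fun_pow 2))).congr_deriv ?_
    simp only [matTDeriv, Fin.mk_one, Matrix.of_apply, Matrix.cons_val_zero,
      Matrix.cons_val_one, Nat.cast_ofNat, Nat.add_one_sub_one]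
    ring

theorem continuous_eval_schwartz {Q : ℝ → 𝓢(ℝ, ℂ)} (hQ : Continuous Q) :
    Continuous fun p : ℝ × ℝ => Q p.2 p.1 := by
  have h : Continuous fun t => SchwartzMap.toBoundedContinuousFunctionCLM ℝ ℝ ℂ (Q t) :=
    (SchwartzMap.toBoundedContinuousFunctionCLM ℝ ℝ ℂ).continuous.comp hQ
  exact (h.comp continuous_snd).eval continuous_fst

theorem continuous_sderiv {Q : ℝ → 𝓢(ℝ, ℂ)} (hQ : Continuous Q) :
    Continuous fun t => sderiv (Q t) :=
  (SchwartzMap.derivCLM ℝ ℂ).continuous.comp hQ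

/-- The seminorm sup |x||Q_s(x)| is continuous in s, hence bounded on `J`. -/
theorem eventually_norm_schwartz_lt {Q : ℝ → 𝓢(ℝ, ℂ)} (hQ : Continuous Q) {J : Set ℝ}
    (hJ : IsCompact J) {ε : ℝ} (hε : 0 < ε) :
    ∀ᶠ x in cocompact ℝ, ∀ s ∈ J, ‖Q s x‖ < ε := by
  have hc : Continuous fun s => SchwartzMap.seminorm ℝ 1 0 (Q s) :=
    ((schwartz_withSeminorms ℝ ℝ ℂ).continuous_seminorm (1, 0)).comp hQ
  obtain ⟨C, hC⟩ := hJ.exists_bound_of_continuousOn hc.continuousOn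
  filter_upwards [(tendsto_norm_cocompact_atTop (E := ℝ)).eventually_gt_atTop (C / ε),
    (tendsto_norm_cocompact_atTop (E := ℝ)).eventually_gt_atTop 0] with x hx hx0 s hs
  have h1 := SchwartzMap.norm_pow_mul_le_seminorm ℝ (Q s) 1 x
  have h2 : SchwartzMap.seminorm ℝ 1 0 (Q s) ≤ C := (Real.le_norm_self _).trans (hC s hs)
  rw [pow_one] at h1
  rw [div_lt_iff₀ hε] at hx
  exact lt_of_mul_lt_mul_left (h1.trans_lt (h2.trans_lt hx)) hx0.le

theorem continuous_op_matT (ζ : ℂ) :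
    Continuous fun p : ℂ × ℂ × ℂ × ℂ => op (matT ζ p.1 p.2.1 p.2.2.1 p.2.2.2) := by
  refine continuous_op.comp (continuous_matrix fun i j => ?_)
  fin_cases i <;> fin_cases j <;> simp [matT] <;> fun_prop

theorem op_matT_zero (ζ : ℂ) (v : Fin 2 → ℂ) (k : Fin 2) :
    op (matT ζ 0 0 0 0) v k = -2 * Complex.I * sgn k * ζ ^ 4 * v k := by
  fin_cases k <;> simp [op_apply, matT, sgn, Matrix.mulVec, dotProduct, Fin.sum_univ_two]

variable {q r : ℝ → 𝓢(ℝ, ℂ)}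

theorem continuous_op_matTAt (hq : Continuous q) (hr : Continuous r) (ζ : ℂ) (x : ℝ) :
    Continuous fun t => op (matTAt ζ (q t) (r t) x) := by
  have h : ∀ {Q : ℝ → 𝓢(ℝ, ℂ)}, Continuous Q → Continuous fun t => Q t x := fun hQ =>
    (continuous_eval_schwartz hQ).comp (by fun_prop : Continuous fun t : ℝ => (x, t))
  have h4 : Continuous fun t => (q t x, r t x, sderiv (q t) x, sderiv (r t) x) :=
    (h hq).prodMk ((h hr).prodMk ((h (continuous_sderiv hq)).prodMk (h (continuous_sderiv hr))))
  simpa only [matTAt_eq, Function.comp_def] using (continuous_op_matT ζ).comp h4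

theorem eventually_norm_op_matTAt_sub_lt (hq : Continuous q) (hr : Continuous r) (ζ : ℂ)
    {J : Set ℝ} (hJ : IsCompact J) {ε : ℝ} (hε : 0 < ε) :
    ∀ᶠ x in cocompact ℝ, ∀ s ∈ J,
      ‖op (matTAt ζ (q s) (r s) x) - op (matT ζ 0 0 0 0)‖ < ε := by
  obtain ⟨η, hη, hηε⟩ := Metric.continuousAt_iff.1
    ((continuous_op_matT ζ).continuousAt (x := (0, 0, 0, 0))) ε hε
  filter_upwards [eventually_norm_schwartz_lt hq hJ hη, eventually_norm_schwartz_lt hr hJ hη,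
    eventually_norm_schwartz_lt (continuous_sderiv hq) hJ hη,
    eventually_norm_schwartz_lt (continuous_sderiv hr) hJ hη] with x h1 h2 h3 h4 s hs
  have h := @hηε (q s x, r s x, sderiv (q s) x, sderiv (r s) x)
    (by simp only [Prod.dist_eq, dist_zero_right, max_lt_iff]
        exact ⟨h1 s hs, h2 s hs, h3 s hs, h4 s hs⟩)
  rw [dist_eq_norm] at h
  exact h

theorem continuous_op_matTDeriv (hq : Continuous q) (hr : Continuous r) (ζ : ℂ) :
    Continuous fun p : ℝ × ℝ => op (matTDeriv ζ (q p.2 p.1) (r p.2 p.1) (sderiv (q p.2) p.1)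
      (sderiv (r p.2) p.1) (sderiv (sderiv (q p.2)) p.1) (sderiv (sderiv (r p.2)) p.1)) := by
  have hpoly : Continuous fun p : ℂ × ℂ × ℂ × ℂ × ℂ × ℂ =>
      op (matTDeriv ζ p.1 p.2.1 p.2.2.1 p.2.2.2.1 p.2.2.2.2.1 p.2.2.2.2.2) := by
    refine continuous_op.comp (continuous_matrix fun i j => ?_)
    fin_cases i <;> fin_cases j <;> simp [matTDeriv] <;> fun_prop
  have hq' := continuous_sderiv hq
  have hr' := continuous_sderiv hr
  have h := hpoly.comp ((continuous_eval_schwartz hq).prodMk ((continuous_eval_schwartz hr).prodMk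
    ((continuous_eval_schwartz hq').prodMk ((continuous_eval_schwartz hr').prodMk
      ((continuous_eval_schwartz (continuous_sderiv hq')).prodMk
        (continuous_eval_schwartz (continuous_sderiv hr')))))))
  simpa only [Function.comp_def] using h

/-- A solution of the linear system at time `0`, evolved by `g_t = 𝒯 g`, stays a solution. -/
theorem isSolution_of_evolution (hq : Continuous q) (hr : Continuous r) (hT : GovernedByT q r)
    {ζ : ℂ} {g : ℝ → ℝ → Fin 2 → ℂ} (hg0 : IsSolution (q 0) (r 0) ζ fun x => g x 0)
    (hg : ∀ x t, HasDerivAt (g x) (op (matTAt ζ (q t) (r t) x) (g x t)) t) (t : ℝ) :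
    IsSolution (q t) (r t) ζ fun x => g x t := by
  intro x
  refine hasDerivAt_of_zeroCurvature
    (T := fun x t => op (matTAt ζ (q t) (r t) x))
    (Tx := fun x t => op (matTDeriv ζ (q t x) (r t x) (sderiv (q t) x)
      (sderiv (r t) x) (sderiv (sderiv (q t)) x) (sderiv (sderiv (r t)) x)))
    (M := fun x t => op (matX ζ (q t x) (r t x)))
    (fun x t => hasDerivAt_op fun i j => hasDerivAt_matTAt ζ (q t) (r t) x i j)
    (continuous_op_matTAt hq hr ζ) (continuous_op_matTDeriv hq hr ζ) (fun x t => ?_) hg hg0 x t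
  rw [← op_mul, ← op_mul, ← map_sub, ← map_add]
  refine hasDerivAt_op fun i j => (hT ζ x t i j).congr_deriv ?_
  rw [(hasDerivAt_matTAt ζ (q t) (r t) x i j).deriv]
  simp only [Matrix.add_apply, Matrix.sub_apply]
  ring

/-- Far away, the evolution `g_t = 𝒯 g` is the free one. -/
theorem tendsto_evolution (hq : Continuous q) (hr : Continuous r) {ζ : ℂ}
    {g : ℝ → ℝ → Fin 2 → ℂ}
    (hg : ∀ x t, HasDerivAt (g x) (op (matTAt ζ (q t) (r t) x) (g x t)) t) {l : Filter ℝ}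
    (hl : l ≤ cocompact ℝ) {E : ℝ → ℂ} {C : ℝ} (hC : ∀ᶠ x in l, ∀ k, ‖E x * g x 0 k‖ ≤ C)
    (t : ℝ) (k : Fin 2) :
    Tendsto (fun x => E x * g x t k
      - Complex.exp (-2 * Complex.I * sgn k * ζ ^ 4 * t) * (E x * g x 0 k)) l (𝓝 0) := by
  set ω : ℂ := 2 * Complex.I * sgn k * ζ ^ 4 with hω
  have hJ : IsCompact (Set.uIcc 0 t) := isCompact_uIcc
  obtain ⟨B, hB⟩ := hJ.exists_bound_of_continuousOn
    (by fun_prop : Continuous fun s : ℝ => Complex.exp (ω * s)).continuousOn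
  have hB0 : 0 ≤ B := (norm_nonneg _).trans (hB 0 Set.left_mem_uIcc)
  set K : ℝ := ‖op (matT ζ 0 0 0 0)‖ + 1 with hK
  -- Multiplication by e^{ωs} cancels the free evolution; the remaining s-derivative is e^{ωs}(𝒯 -
  -- 𝒯_free) applied to E g, small uniformly in s far away.
  have hmain : Tendsto (fun x => Complex.exp (ω * t) * (E x * g x t k) - E x * g x 0 k) l (𝓝 0) := by
    rw [Metric.tendsto_nhds]
    intro η hη
    set C' : ℝ := |C| * Real.exp (K * |t|) with hC'
    -- The tolerance η/D for 𝒯 - 𝒯_free makes the total change smaller than η; the 1 keeps D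
    -- positive.
    set D : ℝ := B * C' * |t| + 1 with hD
    have hD0 : 0 < D := by positivity
    filter_upwards [hC, hl (eventually_norm_op_matTAt_sub_lt hq hr ζ hJ (div_pos hη hD0)),
      hl (eventually_norm_op_matTAt_sub_lt hq hr ζ hJ one_pos)] with x h1 h2 h3
    have hEg : ∀ s, HasDerivAt (fun s => E x • g x s)
        (op (matTAt ζ (q s) (r s) x) (E x • g x s)) s := fun s => by
      have : op (matTAt ζ (q s) (r s) x) (E x • g x s)
          = E x • op (matTAt ζ (q s) (r s) x) (g x s) := by
        simp only [op_apply, Matrix.mulVec_smul]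
      rw [this]
      exact (hg x s).const_smul (E x)
    have hE0 : ‖E x • g x 0‖ ≤ |C| :=
      (pi_norm_le_iff_of_nonneg (abs_nonneg C)).2 fun k => (h1 k).trans (le_abs_self C)
    have hEb : ∀ s ∈ Set.uIcc 0 t, ‖E x • g x s‖ ≤ C' := fun s hs => by
      have hsub : Set.uIcc 0 s ⊆ Set.uIcc 0 t := Set.uIcc_subset_uIcc_left hs
      refine (norm_le_exp_of_linear_ode hEg (K := K) (t₀ := 0) (t₁ := s) fun τ hτ => ?_).trans ?_
      · have := h3 τ (hsub hτ)
        calc ‖op (matTAt ζ (q τ) (r τ) x)‖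
            ≤ ‖op (matT ζ 0 0 0 0)‖
              + ‖op (matTAt ζ (q τ) (r τ) x) - op (matT ζ 0 0 0 0)‖ := by
              simpa using norm_add_le (op (matT ζ 0 0 0 0))
                (op (matTAt ζ (q τ) (r τ) x) - op (matT ζ 0 0 0 0))
          _ ≤ K := by rw [hK]; linarith
      · have : |s - 0| ≤ |t| := by simpa using Set.abs_sub_left_of_mem_uIcc hs
        rw [hC']
        gcongr
    have hder : ∀ s : ℝ, HasDerivAt (fun s : ℝ => Complex.exp (ω * s) * (E x • g x s) k)
        (Complex.exp (ω * s) * ((op (matTAt ζ (q s) (r s) x) - op (matT ζ 0 0 0 0))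
          (E x • g x s) k)) s := fun s => by
      have he : HasDerivAt (fun s : ℝ => Complex.exp (ω * s)) (Complex.exp (ω * s) * (ω * 1)) s :=
        ((Complex.ofRealCLM.hasDerivAt (x := s)).const_mul ω).cexp
      refine (he.fun_mul (hasDerivAt_pi.1 (hEg s) k)).congr_deriv ?_
      rw [sub_apply, Pi.sub_apply, op_matT_zero, hω]
      ring
    have hlip := (convex_uIcc (0 : ℝ) t).norm_image_sub_le_of_norm_hasDerivWithin_le
      (C := B * (η / D * C')) (x := 0) (y := t)
      (fun s _ => (hder s).hasDerivWithinAt)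
      (fun s hs => by
        rw [norm_mul]
        refine mul_le_mul (hB s hs) ?_ (norm_nonneg _) hB0
        refine (norm_le_pi_norm _ k).trans ((ContinuousLinearMap.le_opNorm _ _).trans ?_)
        exact mul_le_mul (h2 s hs).le (hEb s hs) (norm_nonneg _) (by positivity))
      Set.left_mem_uIcc Set.right_mem_uIcc
    simp only [Complex.ofReal_zero, mul_zero, Complex.exp_zero, one_mul, Pi.smul_apply,
      smul_eq_mul, sub_zero, Real.norm_eq_abs] at hlip
    rw [dist_zero_right]
    refine hlip.trans_lt ?_
    calc B * (η / D * C') * |t| = η * ((B * C' * |t|) / D) := by ring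
      _ < η * 1 := by
        gcongr
        rw [div_lt_one hD0, hD]
        linarith
      _ = η := mul_one η
  have h2 := hmain.const_mul (Complex.exp (-ω * t))
  rw [mul_zero] at h2
  refine h2.congr fun x => ?_
  have h3 : Complex.exp (-ω * t) * Complex.exp (ω * t) = 1 := by
    rw [← Complex.exp_add]; simp
  have h4 : -2 * Complex.I * sgn k * ζ ^ 4 * t = -ω * t := by rw [hω]; ring
  rw [h4]
  linear_combination (E x * g x t k) * h3

end Evolution

/-! ### Evolution of the Jost solutions -/

section JostEvolution

variable {q r : ℝ → 𝓢(ℝ, ℂ)} {i : Fin 2} {δ : ℝ} {ζ : ℂ}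

theorem startFilter_le (hδ : δ * δ = 1) : startFilter δ ≤ cocompact ℝ := by
  rcases mul_self_eq_one_iff.1 hδ with rfl | rfl
  · rw [startFilter_one]; exact atBot_le_cocompact
  · rw [startFilter_neg_one]; exact atTop_le_cocompact

theorem endFilter_le (hδ : δ * δ = 1) : endFilter δ ≤ cocompact ℝ := by
  rcases mul_self_eq_one_iff.1 hδ with rfl | rfl
  · rw [endFilter_one]; exact atTop_le_cocompact
  · rw [endFilter_neg_one]; exact atBot_le_cocompact

theorem norm_wt (i : Fin 2) (ζ : ℂ) (x : ℝ) :
    ‖wt i ζ x‖ = Real.exp (-(sgn i * (ζ ^ 2).im * x)) := by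
  rw [wt, Complex.norm_exp, Complex.re_mul_ofReal]
  have : Complex.I * sgn i * ζ ^ 2 = (sgn i : ℂ) * (Complex.I * ζ ^ 2) := by ring
  rw [this, Complex.re_ofReal_mul, Complex.I_mul_re]
  ring_nf

theorem eventually_one_le_norm_wt (h : 0 ≤ δ * sgn i * (ζ ^ 2).im) :
    ∀ᶠ x in startFilter δ, 1 ≤ ‖wt i ζ x‖ := by
  rw [startFilter, eventually_map]
  filter_upwards [eventually_le_atBot 0] with x hx
  rw [norm_wt, Real.one_le_exp_iff]
  nlinarith

/-- The Jost solution of kind `(i, δ)`. -/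
noncomputable def jost (i : Fin 2) (δ : ℝ) (q r : ℝ → ℂ) (ζ : ℂ) : ℝ → Fin 2 → ℂ :=
  theFun (IsJost i δ q r ζ)

/-- Up to a scalar factor, the Jost solutions evolve by `f_t = 𝒯 f`. -/
theorem hasDerivAt_jost (hq : Continuous q) (hr : Continuous r) (hT : GovernedByT q r)
    (hδ : δ * δ = 1) (h : 0 ≤ δ * sgn i * (ζ ^ 2).im) (x t : ℝ) :
    HasDerivAt (fun t : ℝ => Complex.exp (-2 * Complex.I * sgn i * ζ ^ 4 * t)
        • jost i δ (q t) (r t) ζ x)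
      (op (matTAt ζ (q t) (r t) x) (Complex.exp (-2 * Complex.I * sgn i * ζ ^ 4 * t)
        • jost i δ (q t) (r t) ζ x)) t := by
  have hJ : IsJost i δ (q 0) (r 0) ζ (jost i δ (q 0) (r 0) ζ) := isJost_theFun hδ h
  choose g hg0 hg using fun x =>
    exists_linear_ode (continuous_op_matTAt hq hr ζ x) 0 (jost i δ (q 0) (r 0) ζ x)
  have hsol := isSolution_of_evolution hq hr hT (g := g) (by simpa only [hg0] using hJ.1) hg
  obtain ⟨C, hC⟩ := IsJost.exists_bound (q := q 0) (r := r 0) (i := i) hδ ‖ζ‖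
  have hb : ∀ᶠ x in startFilter δ, ∀ k, ‖wt i ζ x * g x 0 k‖ ≤ C :=
    .of_forall fun x k => by rw [hg0]; exact hC ζ _ le_rfl h hJ x k
  -- The evolved solution divided by the phase of its component i has the Jost asymptotics at time
  -- t, so uniqueness applies.
  have heq : ∀ t : ℝ, Complex.exp (-2 * Complex.I * sgn i * ζ ^ 4 * t) • jost i δ (q t) (r t) ζ
      = fun x => g x t := fun t => by
    set e : ℂ := Complex.exp (-2 * Complex.I * sgn i * ζ ^ 4 * t) with he
    have he0 : e ≠ 0 := Complex.exp_ne_zero _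
    have hlim := fun k => tendsto_evolution hq hr hg (startFilter_le hδ) hb t k
    have h1 : Tendsto (fun x => wt i ζ x * g x t i) (startFilter δ) (𝓝 e) := by
      have h2 := (hlim i).add (hJ.2.1.const_mul e)
      rw [zero_add, mul_one] at h2
      refine h2.congr fun x => ?_
      simp only [hg0, he, sub_add_cancel]
    have h3 : Tendsto (fun x => wt i ζ x * g x t (1 - i)) (startFilter δ) (𝓝 0) := by
      have h2 := (hlim (1 - i)).add ((hJ.tendsto_compl hδ h).const_mul
        (Complex.exp (-2 * Complex.I * sgn (1 - i) * ζ ^ 4 * t)))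
      rw [mul_zero, add_zero] at h2
      refine h2.congr fun x => ?_
      simp only [hg0, sub_add_cancel]
    have hjost : IsJost i δ (q t) (r t) ζ (fun x => e⁻¹ • g x t) := by
      refine ⟨fun x => ?_, ?_, ?_⟩
      · rw [Matrix.mulVec_smul]
        exact (hsol t x).const_smul e⁻¹
      · have h4 := h1.const_mul e⁻¹
        rw [inv_mul_cancel₀ he0] at h4
        refine h4.congr fun x => ?_
        simp only [Pi.smul_apply, smul_eq_mul]
        ring
      -- The weighted limit is the one that `tendsto_evolution` provides; since the weight has
      -- modulus at least 1 here, it can be dropped.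
      · have h4 : Tendsto (fun x => g x t (1 - i)) (startFilter δ) (𝓝 0) := by
          refine squeeze_zero_norm' ?_ (tendsto_zero_iff_norm_tendsto_zero.1 h3)
          filter_upwards [eventually_one_le_norm_wt h] with x hx
          rw [norm_mul]
          exact le_mul_of_one_le_left (norm_nonneg _) hx
        simpa using h4.const_mul e⁻¹
    rw [jost, hjost.eq_theFun hδ h]
    funext x
    simp [smul_smul, he0]
  have heq' : ∀ s : ℝ, Complex.exp (-2 * Complex.I * sgn i * ζ ^ 4 * s)
      • jost i δ (q s) (r s) ζ x = g x s := fun s => congrFun (heq s) x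
  simp only [heq']
  exact hg x t

/-- Component k evolves freely with the phase e^{-2is_kζ⁴t}, and the factor e^{2is_iζ⁴t} undoes the
prefactor of `hasDerivAt_jost`. The condition on |E| keeps the weighted Jost solution bounded. -/
theorem exp_mul_jost_tendsto (hq : Continuous q) (hr : Continuous r) (hT : GovernedByT q r)
    (hδ : δ * δ = 1) (h : 0 ≤ δ * sgn i * (ζ ^ 2).im) {E : ℝ → ℂ}
    (hE : ∀ x, ‖E x‖ = ‖wt i ζ x‖) {k : Fin 2} {a : ℂ}
    (ha : Tendsto (fun x => E x * jost i δ (q 0) (r 0) ζ x k) (endFilter δ) (𝓝 a)) (t : ℝ) :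
    Tendsto (fun x => E x * jost i δ (q t) (r t) ζ x k) (endFilter δ)
      (𝓝 (Complex.exp (2 * Complex.I * (sgn i - sgn k) * ζ ^ 4 * t) * a)) := by
  have hJ : IsJost i δ (q 0) (r 0) ζ (jost i δ (q 0) (r 0) ζ) := isJost_theFun hδ h
  obtain ⟨C, hC⟩ := IsJost.exists_bound (q := q 0) (r := r 0) (i := i) hδ ‖ζ‖
  have hg := fun x t => hasDerivAt_jost hq hr hT hδ h x t
  have hb : ∀ᶠ x in endFilter δ, ∀ k, ‖E x * (Complex.exp (-2 * Complex.I * sgn i * ζ ^ 4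
      * (0 : ℝ)) • jost i δ (q 0) (r 0) ζ x) k‖ ≤ C := .of_forall fun x k => by
    have := hC ζ _ le_rfl h hJ x k
    rw [norm_mul] at this ⊢
    simpa [hE] using this
  have hlim := (tendsto_evolution hq hr hg (endFilter_le hδ) hb t k).add
    (ha.const_mul (Complex.exp (-2 * Complex.I * sgn k * ζ ^ 4 * t)))
  have h2 := hlim.const_mul (Complex.exp (2 * Complex.I * sgn i * ζ ^ 4 * t))
  have h3 : Complex.exp (2 * Complex.I * sgn i * ζ ^ 4 * t)
      * Complex.exp (-2 * Complex.I * sgn i * ζ ^ 4 * t) = 1 := by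
    rw [← Complex.exp_add, Complex.exp_eq_one_iff]
    exact ⟨0, by ring_nf⟩
  have h4 : Complex.exp (2 * Complex.I * (sgn i - sgn k) * ζ ^ 4 * t)
      = Complex.exp (2 * Complex.I * sgn i * ζ ^ 4 * t)
        * Complex.exp (-2 * Complex.I * sgn k * ζ ^ 4 * t) := by
    rw [← Complex.exp_add]
    ring_nf
  rw [zero_add, ← mul_assoc, ← h4] at h2
  refine h2.congr fun x => ?_
  simp only [Pi.smul_apply, smul_eq_mul, Complex.ofReal_zero, mul_zero, Complex.exp_zero, one_mul,
    sub_add_cancel]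
  linear_combination (E x * jost i δ (q t) (r t) ζ x k) * h3

end JostEvolution

/-! ### Taylor polynomials and pole orders -/

section PrincipalParts

/-- The limit at l₀ kills the constant term; division by l - l₀ then lowers the degree. -/
theorem eq_zero_of_isBigO_pow {l₀ : ℂ} {m : ℕ} {d : Fin m → ℂ}
    (h : (fun l : ℂ => ∑ k : Fin m, d k * (l - l₀) ^ (k : ℕ)) =O[𝓝[≠] l₀] fun l => (l - l₀) ^ m) :
    d = 0 := by
  induction m with
  | zero => exact Subsingleton.elim _ _
  | succ m ih =>
    simp only [Fin.sum_univ_succ, Fin.val_zero, pow_zero, mul_one, Fin.val_succ] at h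
    have hsub : Tendsto (fun l : ℂ => l - l₀) (𝓝[≠] l₀) (𝓝 0) := by
      have : Tendsto (fun l : ℂ => l - l₀) (𝓝 l₀) (𝓝 (l₀ - l₀)) :=
        (by fun_prop : Continuous fun l : ℂ => l - l₀).continuousAt
      rw [sub_self] at this
      exact this.mono_left nhdsWithin_le_nhds
    have hlim : Tendsto (fun l : ℂ => d 0 + ∑ k : Fin m, d k.succ * (l - l₀) ^ ((k : ℕ) + 1))
        (𝓝[≠] l₀) (𝓝 (d 0 + ∑ k : Fin m, d k.succ * 0 ^ ((k : ℕ) + 1))) :=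
      (tendsto_finsetSum _ fun k _ => (hsub.pow _).const_mul _).const_add _
    have h0 : d 0 = 0 := by
      have h1 := h.trans_tendsto (by simpa using hsub.pow (m + 1))
      simpa using tendsto_nhds_unique hlim h1
    have h2 : (fun l : ℂ => ∑ k : Fin m, d k.succ * (l - l₀) ^ (k : ℕ))
        =O[𝓝[≠] l₀] fun l => (l - l₀) ^ m := by
      refine (h.mul (isBigO_refl (fun l : ℂ => (l - l₀)⁻¹) _)).congr' ?_ ?_
      · filter_upwards [self_mem_nhdsWithin] with l hl
        have hl' : l - l₀ ≠ 0 := sub_ne_zero.2 hl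
        rw [h0, zero_add, Finset.sum_mul]
        refine Finset.sum_congr rfl fun k _ => ?_
        field_simp
        ring
      · filter_upwards [self_mem_nhdsWithin] with l hl
        have hl' : l - l₀ ≠ 0 := sub_ne_zero.2 hl
        field_simp
        ring
    have h3 := ih h2
    funext k
    refine Fin.cases h0 (fun j => ?_) k
    exact congrFun h3 j

theorem exists_taylorPoly_isBigO {F : ℂ → ℂ} {l₀ : ℂ} (hF : AnalyticAt ℂ F l₀) (m : ℕ) :
    ∃ γ : Fin m → ℂ, (fun l => F l - taylorPoly l₀ γ l) =O[𝓝 l₀] fun l => (l - l₀) ^ m := by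
  obtain ⟨p, hp⟩ := hF
  refine ⟨fun k => (k : ℕ).factorial * p.coeff k, ?_⟩
  have hsub : Tendsto (fun l : ℂ => l - l₀) (𝓝 l₀) (𝓝 0) := by
    have : Tendsto (fun l : ℂ => l - l₀) (𝓝 l₀) (𝓝 (l₀ - l₀)) :=
      (by fun_prop : Continuous fun l : ℂ => l - l₀).continuousAt
    rwa [sub_self] at this
  have h := ((hp.isBigO_sub_partialSum_pow m).comp_tendsto hsub).trans
    (isBigO_of_le (g := fun l : ℂ => (l - l₀) ^ m) _ fun l => by simp)
  refine h.congr_left fun l => ?_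
  simp only [Function.comp_apply, add_sub_cancel, FormalMultilinearSeries.partialSum,
    FormalMultilinearSeries.apply_eq_pow_smul_coeff, taylorPoly, smul_eq_mul]
  rw [Finset.sum_range]
  congr 1
  refine Finset.sum_congr rfl fun k _ => ?_
  have : ((k : ℕ).factorial : ℂ) ≠ 0 := by exact_mod_cast Nat.factorial_ne_zero _
  field_simp

theorem isBigO_of_meromorphicOrderAt {F : ℂ → ℂ} {l₀ : ℂ} {m : ℕ} (hm : 0 < m)
    (h : meromorphicOrderAt F l₀ = ((-(m : ℤ) : ℤ) : WithTop ℤ)) :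
    (fun l => F l * (l - l₀) ^ m) =O[𝓝[≠] l₀] fun _ => (1 : ℂ) := by
  have hmer : MeromorphicAt F l₀ := by
    -- A function that is not meromorphic has order 0 by convention, which 0 < m excludes.
    by_contra hF
    rw [meromorphicOrderAt_of_not_meromorphicAt hF] at h
    have : (0 : ℤ) = -(m : ℤ) := by exact_mod_cast h
    omega
  obtain ⟨g, hg, -, hFg⟩ := (meromorphicOrderAt_eq_int_iff hmer).1 h
  refine ((hg.continuousAt.isBigO_one ℂ).mono nhdsWithin_le_nhds).congr' ?_ .rfl
  filter_upwards [hFg, self_mem_nhdsWithin] with l hl hne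
  have hl' : l - l₀ ≠ 0 := sub_ne_zero.2 hne
  rw [hl, zpow_neg, zpow_natCast, smul_eq_mul]
  field_simp

end PrincipalParts

/-! ### The square root of λ -/

section Csqrt

theorem csqrt_sq (l : ℂ) : csqrt l ^ 2 = l := by
  simp [csqrt]

theorem norm_csqrt_sq (l : ℂ) : ‖csqrt l‖ ^ 2 = ‖l‖ := by rw [← norm_pow, csqrt_sq]

theorem norm_csqrt_le (l : ℂ) : ‖csqrt l‖ ≤ ‖l‖ + 1 := by
  nlinarith [norm_csqrt_sq l, sq_nonneg (‖csqrt l‖ - 1), norm_nonneg (csqrt l)]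

/-- Only |√λ|² = |λ| is used, so the branch cut plays no role. -/
theorem isBigO_inv_csqrt {l₀ : ℂ} (h : l₀ ≠ 0) :
    (fun l => (csqrt l)⁻¹) =O[𝓝 l₀] fun _ => (1 : ℂ) := by
  have h1 : (fun l : ℂ => l⁻¹) =O[𝓝 l₀] fun _ => (1 : ℂ) :=
    (continuousAt_inv₀ h).isBigO_one ℂ
  obtain ⟨C, hC⟩ := h1.bound
  refine IsBigO.of_bound (C + 1) ?_
  filter_upwards [hC] with l hl
  have h2 := norm_csqrt_sq l
  rw [norm_inv, ← h2, ← inv_pow] at hl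
  rw [norm_inv]
  simp only [norm_one, mul_one] at hl ⊢
  nlinarith [sq_nonneg (‖csqrt l‖⁻¹ - 1)]

end Csqrt

/-! ### Multiplication of principal parts by e^{κλ²} through Jordan blocks -/

section Jordan

/-- The coefficients of the principal part `∑_k c'_k (λ - λ₀)^{-k-1}` of
`e^{κ λ²} ∑_k c_k (λ - λ₀)^{-k-1}`. -/
noncomputable def transport (κ l₀ : ℂ) {m : ℕ} (c : Fin m → ℂ) (k : Fin m) : ℂ :=
  ∑ a : Fin m, c a.rev * NormedSpace.exp (κ • jordanBlock l₀ m ^ 2) a k.rev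

open scoped Matrix.Norms.Operator in
theorem exp_matrix_family_apply {N : ℕ} {m : Fin N → ℕ}
    (M : (j : Fin N) → Matrix (Fin (m j)) (Fin (m j)) ℂ) (j : Fin N) :
    NormedSpace.exp M j = NormedSpace.exp (M j) :=
  Pi.coe_exp M j

/-- Powers and the exponential respect the block diagonal structure, so the update of C can be
studied one pole at a time. -/
theorem matC_mul_exp {N : ℕ} (lam : Fin N → ℂ) (m : Fin N → ℕ) (c : (j : Fin N) → Fin (m j) → ℂ)
    (κ : ℂ) : matC m c * NormedSpace.exp (κ • matA lam m ^ 2)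
      = matC m fun j => transport κ (lam j) (c j) := by
  have h : κ • matA lam m ^ 2
      = Matrix.blockDiagonal' (κ • (fun j => jordanBlock (lam j) (m j)) ^ 2) := by
    rw [matA, ← Matrix.blockDiagonal'_pow, ← Matrix.blockDiagonal'_smul]
  rw [h, Matrix.exp_blockDiagonal']
  ext u ⟨j, b⟩
  rw [Matrix.mul_apply, Fintype.sum_sigma, Finset.sum_eq_single j]
  · simp only [matC, transport, Matrix.of_apply, Matrix.blockDiagonal'_apply_eq, Fin.rev_rev]
    refine Finset.sum_congr rfl fun a _ => ?_
    rw [exp_matrix_family_apply]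
    rfl
  · intro i _ hi
    refine Finset.sum_eq_zero fun a _ => ?_
    rw [Matrix.blockDiagonal'_apply_ne _ _ _ hi, mul_zero]
  · simp

/-- The vector `(λ - J)⁻¹ B` for the Jordan block `J` and the column `B = (0, …, 0, 1)`. -/
noncomputable def resolventVec (l₀ : ℂ) (m : ℕ) (l : ℂ) (b : Fin m) : ℂ :=
  ((l - l₀) ^ (m - (b : ℕ)))⁻¹

/-- The reversed order of the constants in the row C matches the descending powers in (λ-J)⁻¹B. -/
theorem sum_div_eq_dotProduct (l₀ : ℂ) {m : ℕ} (c : Fin m → ℂ) (l : ℂ) :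
    ∑ k : Fin m, c k / (l - l₀) ^ ((k : ℕ) + 1)
      = (fun a : Fin m => c a.rev) ⬝ᵥ resolventVec l₀ m l := by
  rw [dotProduct, ← Equiv.sum_comp Fin.revPerm]
  refine Finset.sum_congr rfl fun k _ => ?_
  have h : m - (k : ℕ) - 1 + 1 = m - (k : ℕ) := by have := k.2; omega
  rw [Fin.revPerm_apply, Fin.val_rev, resolventVec, div_eq_mul_inv, ← h]
  rfl

/-- The column `(0, …, 0, 1)`. -/
def lastVec (m : ℕ) (b : Fin m) : ℂ := if (b : ℕ) + 1 = m then 1 else 0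

theorem jordanBlock_mulVec_resolventVec {l₀ l : ℂ} (m : ℕ) (hl : l ≠ l₀) :
    (jordanBlock l₀ m).mulVec (resolventVec l₀ m l)
      = l • resolventVec l₀ m l - lastVec m := by
  have hl' : l - l₀ ≠ 0 := sub_ne_zero.2 hl
  funext a
  have hsplit : ∀ b : Fin m, jordanBlock l₀ m a b * resolventVec l₀ m l b
      = (if a = b then l₀ * resolventVec l₀ m l b else 0)
        + (if (a : ℕ) + 1 = b then resolventVec l₀ m l b else 0) := fun b => by
    simp only [jordanBlock, Matrix.of_apply]
    by_cases h1 : a = b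
    · have h2 : ¬ (a : ℕ) + 1 = b := by rw [h1]; omega
      simp [h1]
    · simp [h1]
  simp only [Matrix.mulVec, dotProduct, hsplit, Finset.sum_add_distrib, Finset.sum_ite_eq,
    Finset.mem_univ, if_true, Pi.sub_apply, Pi.smul_apply, smul_eq_mul, lastVec]
  by_cases ha : (a : ℕ) + 1 = m
  · have h0 : ∑ b : Fin m, (if (a : ℕ) + 1 = b then resolventVec l₀ m l b else 0) = 0 :=
      Finset.sum_eq_zero fun b _ => if_neg (by have := b.2; omega)
    have h1 : m - (a : ℕ) = 1 := by omega
    rw [h0, if_pos ha, resolventVec, h1]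
    field_simp
    ring
  · have hlt : (a : ℕ) + 1 < m := by have := a.2; omega
    have h0 : ∑ b : Fin m, (if (a : ℕ) + 1 = b then resolventVec l₀ m l b else 0)
        = resolventVec l₀ m l ⟨a + 1, hlt⟩ := by
      rw [Finset.sum_eq_single ⟨a + 1, hlt⟩]
      · simp
      · intro b _ hb
        exact if_neg fun h => hb (Fin.ext h.symm)
      · simp
    have h1 : m - (a : ℕ) = m - ((a : ℕ) + 1) + 1 := by omega
    rw [h0, if_neg ha, resolventVec, resolventVec, h1]
    simp only [pow_succ]
    field_simp
    ring

-- With e = (λ-J)⁻¹B one has Je = λe - B, hence J²e = λ²e - (λB + JB): the pole of e drops out of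
-- (J² - λ²)e. Gronwall along s ∈ [0, 1] passes from the generators κJ² and κλ² to their
-- exponentials.
open scoped Matrix.Norms.Operator in
theorem exists_bound_exp_mulVec_sub (κ l₀ : ℂ) (m : ℕ) : ∃ C, ∀ᶠ l in 𝓝[≠] l₀,
    ‖(NormedSpace.exp (κ • jordanBlock l₀ m ^ 2)).mulVec (resolventVec l₀ m l)
      - Complex.exp (κ * l ^ 2) • resolventVec l₀ m l‖ ≤ C := by
  set J := jordanBlock l₀ m with hJ
  set M := κ • J ^ 2 with hM
  set R : ℝ := ‖l₀‖ + 1 with hR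
  set ε : ℝ := Real.exp (‖κ‖ * R ^ 2) * (‖κ‖ * (R * ‖lastVec m‖ + ‖J.mulVec (lastVec m)‖)) with hε
  refine ⟨gronwallBound 0 ‖M‖ ε 1, ?_⟩
  filter_upwards [self_mem_nhdsWithin, nhdsWithin_le_nhds (Metric.ball_mem_nhds l₀ one_pos)]
    with l hl hball
  set e := resolventVec l₀ m l with he
  have hlR : ‖l‖ ≤ R := by
    have h1 : ‖l - l₀‖ < 1 := by simpa [dist_eq_norm] using hball
    have h2 := norm_add_le (l - l₀) l₀
    rw [sub_add_cancel] at h2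
    linarith
  have hres := jordanBlock_mulVec_resolventVec m hl
  rw [← hJ, ← he] at hres
  have hMe : M.mulVec e = (κ * l ^ 2) • e - κ • (l • lastVec m + J.mulVec (lastVec m)) := by
    rw [hM, Matrix.smul_mulVec, pow_two, ← Matrix.mulVec_mulVec, hres, Matrix.mulVec_sub,
      Matrix.mulVec_smul, hres]
    module
  -- The difference vanishes at s = 0 and solves u' = Mu plus a forcing term that stays bounded as l
  -- → l₀, although e itself does not.
  have hder : ∀ s : ℝ, HasDerivAt (fun s : ℝ => (NormedSpace.exp (s • M)).mulVec e
        - Complex.exp (s * (κ * l ^ 2)) • e)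
      (M.mulVec ((NormedSpace.exp (s • M)).mulVec e - Complex.exp (s * (κ * l ^ 2)) • e)
        - Complex.exp (s * (κ * l ^ 2)) • κ • (l • lastVec m + J.mulVec (lastVec m))) s := by
    intro s
    have h1 : HasDerivAt (fun s : ℝ => NormedSpace.exp (s • M)) (M * NormedSpace.exp (s • M)) s :=
      hasDerivAt_exp_smul_const' M s
    let L : Matrix (Fin m) (Fin m) ℂ →ₗ[ℝ] (Fin m → ℂ) :=
      { toFun := fun A => A.mulVec e
        map_add' := fun A B => Matrix.add_mulVec A B e
        map_smul' := fun r A => Matrix.smul_mulVec r A e }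
    have h2 : HasDerivAt (fun s : ℝ => (NormedSpace.exp (s • M)).mulVec e)
        ((M * NormedSpace.exp (s • M)).mulVec e) s :=
      (LinearMap.toContinuousLinearMap L).hasFDerivAt.comp_hasDerivAt s h1
    have h3 : HasDerivAt (fun s : ℝ => Complex.exp (s * (κ * l ^ 2)))
        (Complex.exp (s * (κ * l ^ 2)) * (1 * (κ * l ^ 2))) s :=
      ((Complex.ofRealCLM.hasDerivAt (x := s)).mul_const (κ * l ^ 2)).cexp
    refine (h2.fun_sub (h3.smul_const e)).congr_deriv ?_
    rw [Matrix.mulVec_sub, Matrix.mulVec_smul, hMe, Matrix.mulVec_mulVec]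
    module
  have hfin := norm_le_gronwallBound_uIcc hder (t₀ := 0) (t₁ := 1) (K := ‖M‖) (ε := ε) fun s hs => by
    refine (norm_sub_le _ _).trans (add_le_add (Matrix.linfty_opNorm_mulVec _ _) ?_)
    rw [Set.uIcc_of_le zero_le_one] at hs
    rw [norm_smul, norm_smul, Complex.norm_exp, hε]
    refine mul_le_mul (Real.exp_le_exp.2 ?_) ?_ (by positivity) (by positivity)
    · refine (Complex.re_le_norm _).trans ?_
      rw [norm_mul, norm_mul, norm_pow, Complex.norm_real, Real.norm_eq_abs, abs_of_nonneg hs.1]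
      calc s * (‖κ‖ * ‖l‖ ^ 2) ≤ 1 * (‖κ‖ * R ^ 2) := by gcongr; exact hs.2
        _ = _ := one_mul _
    · gcongr
      refine (norm_add_le _ _).trans ?_
      rw [norm_smul]
      gcongr
  simpa using hfin

theorem isBigO_exp_mul_sum_sub (κ l₀ : ℂ) {m : ℕ} (c : Fin m → ℂ) :
    (fun l : ℂ => Complex.exp (κ * l ^ 2) * ∑ k : Fin m, c k / (l - l₀) ^ ((k : ℕ) + 1)
        - ∑ k : Fin m, transport κ l₀ c k / (l - l₀) ^ ((k : ℕ) + 1))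
      =O[𝓝[≠] l₀] fun _ => (1 : ℂ) := by
  obtain ⟨C, hC⟩ := exists_bound_exp_mulVec_sub κ l₀ m
  refine IsBigO.of_bound (∑ k : Fin m, ‖c k.rev‖ * C) ?_
  filter_upwards [hC] with l hl
  rw [norm_sub_rev] at hl
  have h1 : (fun a : Fin m => transport κ l₀ c a.rev)
      = Matrix.vecMul (fun a : Fin m => c a.rev) (NormedSpace.exp (κ • jordanBlock l₀ m ^ 2)) := by
    funext a
    simp [transport, Matrix.vecMul, dotProduct]
  rw [sum_div_eq_dotProduct, sum_div_eq_dotProduct, h1, ← Matrix.dotProduct_mulVec, ← smul_eq_mul,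
    ← dotProduct_smul, ← dotProduct_sub, norm_one, mul_one]
  refine (norm_sum_le _ _).trans (Finset.sum_le_sum fun k _ => ?_)
  rw [norm_mul]
  gcongr
  exact (norm_le_pi_norm _ k).trans hl

end Jordan

/-! ### Uniqueness and transport of the normalization constants -/

section Normalization

variable {f g f₀ g₀ f₁ g₁ : ℂ → ℝ → Fin 2 → ℂ} {T T₀ T₁ : ℂ → ℂ} {l₀ σ κ : ℂ} {m : ℕ}

/-- Near `l₀`, the solutions `g` do not degenerate. -/
def Nondegenerate (g : ℂ → ℝ → Fin 2 → ℂ) (l₀ : ℂ) : Prop :=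
  ∃ (x : ℝ) (i : Fin 2) (c : ℝ), 0 < c ∧ ∀ᶠ l in 𝓝 l₀, c ≤ ‖g (csqrt l) x i‖

/-- The difference of the two polynomials times g is O((λ-λ₀)^m); dividing by a component of g
bounded away from 0 leaves a polynomial of degree below m. -/
theorem IsDependency.unique (hg : Nondegenerate g l₀) {γ γ' : Fin m → ℂ}
    (h : IsDependency f g l₀ γ) (h' : IsDependency f g l₀ γ') : γ = γ' := by
  obtain ⟨x, i, c, hc, hgc⟩ := hg
  have h1 : (fun l => (taylorPoly l₀ γ' l - taylorPoly l₀ γ l) * g (csqrt l) x i)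
      =O[𝓝 l₀] fun l => (l - l₀) ^ m :=
    ((h x i).sub (h' x i)).congr_left fun l => by ring
  have h2 : (fun l => taylorPoly l₀ γ' l - taylorPoly l₀ γ l)
      =O[𝓝 l₀] fun l => (taylorPoly l₀ γ' l - taylorPoly l₀ γ l) * g (csqrt l) x i := by
    refine IsBigO.of_bound c⁻¹ ?_
    filter_upwards [hgc] with l hl
    rw [norm_mul, inv_mul_eq_div, le_div_iff₀ hc]
    gcongr
  have h3 : (fun l => ∑ k : Fin m, ((γ' k - γ k) / ((k : ℕ).factorial : ℂ)) * (l - l₀) ^ (k : ℕ))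
      =O[𝓝[≠] l₀] fun l => (l - l₀) ^ m := by
    refine ((h2.trans h1).mono nhdsWithin_le_nhds).congr_left fun l => ?_
    simp only [taylorPoly, ← Finset.sum_sub_distrib]
    refine Finset.sum_congr rfl fun k _ => ?_
    ring
  have h4 := eq_zero_of_isBigO_pow h3
  funext k
  have h5 := congrFun h4 k
  have : ((k : ℕ).factorial : ℂ) ≠ 0 := by exact_mod_cast Nat.factorial_ne_zero _
  simp only [Pi.zero_apply, div_eq_zero_iff, this, or_false] at h5
  exact (sub_eq_zero.1 h5).symm

theorem IsNormalization.unique (hg : Nondegenerate g l₀) {c c' : Fin m → ℂ}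
    (h : IsNormalization σ T f g l₀ c) (h' : IsNormalization σ T f g l₀ c') : c = c' := by
  obtain ⟨γ, hγ, hc⟩ := h
  obtain ⟨γ', hγ', hc'⟩ := h'
  obtain rfl := hγ.unique hg hγ'
  -- Multiplying the difference of principal parts by (l - l₀)^m gives a polynomial with the
  -- coefficients in reversed order.
  have h1 : (fun l => ∑ k : Fin m, (c' k.rev - c k.rev) * (l - l₀) ^ (k : ℕ))
      =O[𝓝[≠] l₀] fun l => (l - l₀) ^ m := by
    refine ((hc.sub hc').mul (isBigO_refl (fun l : ℂ => (l - l₀) ^ m) _)).congr' ?_ ?_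
    · filter_upwards [self_mem_nhdsWithin] with l hl
      have hl' : l - l₀ ≠ 0 := sub_ne_zero.2 hl
      rw [sub_sub_sub_cancel_left, ← Finset.sum_sub_distrib, Finset.sum_mul,
        ← Equiv.sum_comp Fin.revPerm]
      refine Finset.sum_congr rfl fun k _ => ?_
      have h2 : (l - l₀) ^ m = (l - l₀) ^ ((k.rev : ℕ) + 1) * (l - l₀) ^ (k : ℕ) := by
        rw [← pow_add, Fin.val_rev]
        congr 1
        have := k.2
        omega
      rw [Fin.revPerm_apply, h2]
      field_simp
    · exact .of_forall fun l => one_mul _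
  have h3 := eq_zero_of_isBigO_pow h1
  funext k
  have h4 := congrFun h3 k.rev
  simp only [Fin.rev_rev, Pi.zero_apply] at h4
  exact (sub_eq_zero.1 h4).symm

/-- The pairs `(f₀, g₀)` and `(f₁, g₁)` of solutions are related by an invertible linear evolution,
up to the scalar factor `e^{κλ²}` between `f` and `g`. -/
def IsEvolved (κ : ℂ) (f₀ g₀ f₁ g₁ : ℂ → ℝ → Fin 2 → ℂ) (l₀ : ℂ) : Prop :=
  ∀ x, ∃ C, ∀ᶠ l in 𝓝 l₀, ∀ Γ : ℂ,
    ‖f₁ (csqrt l) x - (Complex.exp (κ * l ^ 2) * Γ) • g₁ (csqrt l) x‖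
      ≤ C * ‖f₀ (csqrt l) x - Γ • g₀ (csqrt l) x‖

/-- The new dependency constants are the Taylor coefficients of e^{κλ²}Γ through order m - 1; the
remainder O((λ-λ₀)^m) is harmless, both against bounded g₁ and against the pole of order m of T. -/
theorem IsNormalization.evolve (hl₀ : l₀ ≠ 0) (hm : 0 < m)
    (hT₀ : meromorphicOrderAt (fun l => T₀ (csqrt l)) l₀ = ((-(m : ℤ) : ℤ) : WithTop ℤ))
    (hT : ∀ᶠ l in 𝓝 l₀, T₁ (csqrt l) = T₀ (csqrt l)) (hev : IsEvolved κ f₀ g₀ f₁ g₁ l₀)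
    (hg : ∀ x, ∃ C, ∀ᶠ l in 𝓝 l₀, ‖g₁ (csqrt l) x‖ ≤ C) {c : Fin m → ℂ}
    (h : IsNormalization σ T₀ f₀ g₀ l₀ c) :
    IsNormalization σ T₁ f₁ g₁ l₀ (transport κ l₀ c) := by
  obtain ⟨γ, hγ, hc⟩ := h
  have hexp : AnalyticAt ℂ (fun l : ℂ => Complex.exp (κ * l ^ 2)) l₀ := by fun_prop
  have hpoly : AnalyticAt ℂ (fun l : ℂ => Complex.exp (κ * l ^ 2) * taylorPoly l₀ γ l) l₀ := by
    refine hexp.mul ?_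
    unfold taylorPoly
    fun_prop
  obtain ⟨γ', hγ'⟩ := exists_taylorPoly_isBigO hpoly m
  refine ⟨γ', fun x i => ?_, ?_⟩
  · obtain ⟨C, hC⟩ := hev x
    obtain ⟨D, hD⟩ := hg x
    have h1 : (fun l => f₀ (csqrt l) x - taylorPoly l₀ γ l • g₀ (csqrt l) x)
        =O[𝓝 l₀] fun l => (l - l₀) ^ m :=
      isBigO_pi.2 fun i => hγ x i
    have h2 : (fun l => f₁ (csqrt l) x
          - (Complex.exp (κ * l ^ 2) * taylorPoly l₀ γ l) • g₁ (csqrt l) x)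
        =O[𝓝 l₀] fun l => (l - l₀) ^ m := by
      refine IsBigO.trans (IsBigO.of_bound C ?_) h1
      filter_upwards [hC] with l hl using hl _
    have h3 : (fun l => g₁ (csqrt l) x i) =O[𝓝 l₀] fun _ => (1 : ℂ) := by
      refine IsBigO.of_bound D ?_
      filter_upwards [hD] with l hl
      simpa using (norm_le_pi_norm _ i).trans hl
    refine ((isBigO_pi.1 h2 i).add ((hγ'.mul h3).congr_right fun l => mul_one _)).congr_left
      fun l => ?_
    simp only [Pi.sub_apply, Pi.smul_apply, smul_eq_mul]
    ring
  · have h1 : (fun l => Complex.exp (κ * l ^ 2)) =O[𝓝[≠] l₀] fun _ => (1 : ℂ) :=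
      (hexp.continuousAt.isBigO_one ℂ).mono nhdsWithin_le_nhds
    have h2 := (h1.mul hc).congr_right fun l => one_mul (1 : ℂ)
    have h3 := isBigO_exp_mul_sum_sub κ l₀ c
    -- The cost of truncating e^{κλ²}Γ: a remainder of order m times a pole of order m is bounded.
    have h4 : (fun l => σ * T₀ (csqrt l) / csqrt l
        * (taylorPoly l₀ γ' l - Complex.exp (κ * l ^ 2) * taylorPoly l₀ γ l))
        =O[𝓝[≠] l₀] fun _ => (1 : ℂ) := by
      have h5 := (((isBigO_of_meromorphicOrderAt hm hT₀).mul
        ((isBigO_inv_csqrt hl₀).mono nhdsWithin_le_nhds)).mul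
        ((hγ'.neg_left.mono nhdsWithin_le_nhds).mul
          (isBigO_refl (fun l : ℂ => ((l - l₀) ^ m)⁻¹) _))).const_mul_left σ
      refine h5.congr' ?_ ?_
      · filter_upwards [self_mem_nhdsWithin] with l hl
        have hl' : (l - l₀) ^ m ≠ 0 := pow_ne_zero _ (sub_ne_zero.2 hl)
        field_simp
        ring
      · filter_upwards [self_mem_nhdsWithin] with l hl
        have hl' : (l - l₀) ^ m ≠ 0 := pow_ne_zero _ (sub_ne_zero.2 hl)
        field_simp
    refine ((h2.add h3).add h4).congr' ?_ .rfl
    filter_upwards [nhdsWithin_le_nhds hT] with l hl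
    rw [hl]
    ring

/-- The common form of `IsTriplet` and `IsTripletBar`. -/
def IsBoundStateTriplet (σ : ℂ) (T : ℂ → ℂ) (S : Set ℂ) (f g : ℂ → ℝ → Fin 2 → ℂ) {N : ℕ}
    (lam : Fin N → ℂ) (m : Fin N → ℕ) (A : Matrix (Idx m) (Idx m) ℂ) (B : Matrix (Idx m) Unit ℂ)
    (C : Matrix Unit (Idx m) ℂ) : Prop :=
  IsPoleListing (fun l => T (csqrt l)) S lam m ∧ A = matA lam m ∧ B = matB m ∧
    ∃ c : (j : Fin N) → Fin (m j) → ℂ,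
      (∀ j, IsNormalization σ T f g (lam j) (c j)) ∧ C = matC m c

theorem IsPoleListing.congr {F G : ℂ → ℂ} {S : Set ℂ} (hS : IsOpen S) (h : ∀ l ∈ S, G l = F l)
    {N : ℕ} {lam : Fin N → ℂ} {m : Fin N → ℕ} (hF : IsPoleListing F S lam m) :
    IsPoleListing G S lam m := by
  have hord : ∀ l ∈ S, meromorphicOrderAt G l = meromorphicOrderAt F l := fun l hl =>
    meromorphicOrderAt_congr (nhdsWithin_le_nhds (mem_of_superset (hS.mem_nhds hl) h))
  refine ⟨hF.1, fun j => ?_, fun l hl hlt => hF.2.2 l hl (by rwa [← hord l hl])⟩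
  obtain ⟨h1, h2, h3⟩ := hF.2.1 j
  exact ⟨h1, h2, by rw [hord _ h1, h3]⟩

/-- The transported constants are admissible for the new data, and by nondegeneracy of g₁ they are
the only ones; this gives both directions. -/
theorem isBoundStateTriplet_iff {S : Set ℂ} (hS : IsOpen S) (h0 : ∀ l ∈ S, l ≠ 0)
    (hT : ∀ l ∈ S, T₁ (csqrt l) = T₀ (csqrt l)) (hev : ∀ l ∈ S, IsEvolved κ f₀ g₀ f₁ g₁ l)
    (hg : ∀ l ∈ S, ∀ x, ∃ C, ∀ᶠ l in 𝓝 l, ‖g₁ (csqrt l) x‖ ≤ C)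
    (hnd : ∀ l ∈ S, Nondegenerate g₁ l) {N : ℕ} {lam : Fin N → ℂ} {m : Fin N → ℕ}
    {A : Matrix (Idx m) (Idx m) ℂ} {B : Matrix (Idx m) Unit ℂ} {C : Matrix Unit (Idx m) ℂ}
    (h : IsBoundStateTriplet σ T₀ S f₀ g₀ lam m A B C) (A' : Matrix (Idx m) (Idx m) ℂ)
    (B' : Matrix (Idx m) Unit ℂ) (C' : Matrix Unit (Idx m) ℂ) :
    IsBoundStateTriplet σ T₁ S f₁ g₁ lam m A' B' C' ↔
      A' = A ∧ B' = B ∧ C' = C * NormedSpace.exp (κ • A ^ 2) := by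
  obtain ⟨hpl, rfl, rfl, c, hc, rfl⟩ := h
  have hlS : ∀ j, lam j ∈ S := fun j => (hpl.2.1 j).1
  have hc₁ : ∀ j, IsNormalization σ T₁ f₁ g₁ (lam j) (transport κ (lam j) (c j)) := fun j =>
    (hc j).evolve (h0 _ (hlS j)) (hpl.2.1 j).2.1 (hpl.2.1 j).2.2
      (mem_of_superset (hS.mem_nhds (hlS j)) hT) (hev _ (hlS j)) (hg _ (hlS j))
  rw [matC_mul_exp]
  constructor
  · rintro ⟨-, hA, hB, c', hc', hC⟩
    refine ⟨hA, hB, ?_⟩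
    rw [hC]
    congr 1
    funext j
    exact (hc' j).unique (hnd _ (hlS j)) (hc₁ j)
  · rintro ⟨rfl, rfl, rfl⟩
    exact ⟨hpl.congr hS hT, rfl, rfl, _, hc₁, rfl⟩

end Normalization

/-! ### Bounds and evolution of the Jost solutions near a pole -/

section JostBoundStates

variable {q r : ℝ → 𝓢(ℝ, ℂ)} {i : Fin 2} {δ : ℝ}

theorem abs_sgn (i : Fin 2) : |sgn i| = 1 := by fin_cases i <;> simp [sgn]

theorem norm_wt_le {ζ : ℂ} {Z : ℝ} (hζ : ‖ζ‖ ≤ Z) (x : ℝ) : ‖wt i ζ x‖ ≤ Real.exp (Z ^ 2 * |x|) := by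
  rw [norm_wt, Real.exp_le_exp]
  refine (neg_le_abs _).trans ?_
  rw [abs_mul, abs_mul, abs_sgn, one_mul]
  gcongr
  refine (Complex.abs_im_le_norm _).trans ?_
  rw [norm_pow]
  gcongr

theorem norm_wt_inv_le {ζ : ℂ} {Z : ℝ} (hζ : ‖ζ‖ ≤ Z) (x : ℝ) :
    ‖(wt i ζ x)⁻¹‖ ≤ Real.exp (Z ^ 2 * |x|) := by
  have h : (wt i ζ x)⁻¹ = wt (1 - i) ζ x := by
    rw [wt, wt, ← Complex.exp_neg, sgn_compl]
    push_cast
    ring_nf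
  rw [h]
  exact norm_wt_le hζ x

theorem eventually_norm_csqrt_le (l₀ : ℂ) : ∀ᶠ l in 𝓝 l₀, ‖csqrt l‖ ≤ ‖l₀‖ + 2 := by
  filter_upwards [Metric.ball_mem_nhds l₀ one_pos] with l hl
  have h1 : ‖l - l₀‖ < 1 := by simpa [dist_eq_norm] using hl
  have h2 := norm_add_le (l - l₀) l₀
  rw [sub_add_cancel] at h2
  linarith [norm_csqrt_le l]

theorem eventually_admissible {l₀ : ℂ} (h : 0 < δ * sgn i * l₀.im) :
    ∀ᶠ l in 𝓝 l₀, 0 ≤ δ * sgn i * (csqrt l ^ 2).im := by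
  have hc : Continuous fun l : ℂ => δ * sgn i * l.im := continuous_const.mul Complex.continuous_im
  filter_upwards [hc.continuousAt.eventually (lt_mem_nhds h)] with l hl
  rw [csqrt_sq]
  exact hl.le

theorem eventually_norm_jost_le (q r : 𝓢(ℝ, ℂ)) (hδ : δ * δ = 1) {l₀ : ℂ}
    (h : 0 < δ * sgn i * l₀.im) (x : ℝ) :
    ∃ C, ∀ᶠ l in 𝓝 l₀, ‖jost i δ q r (csqrt l) x‖ ≤ C := by
  obtain ⟨C, hC⟩ := IsJost.exists_bound (q := q) (r := r) (i := i) hδ (‖l₀‖ + 2)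
  refine ⟨Real.exp ((‖l₀‖ + 2) ^ 2 * |x|) * |C|, ?_⟩
  filter_upwards [eventually_norm_csqrt_le l₀, eventually_admissible h] with l hl hadm
  refine (pi_norm_le_iff_of_nonneg (by positivity)).2 fun k => ?_
  have h1 := hC _ _ hl hadm (isJost_theFun hδ hadm) x k
  have h2 : jost i δ q r (csqrt l) x k
      = (wt i (csqrt l) x)⁻¹ * (wt i (csqrt l) x * jost i δ q r (csqrt l) x k) := by
    rw [inv_mul_cancel_left₀ (wt_ne_zero _ _ _)]
  rw [h2, norm_mul]
  exact mul_le_mul (norm_wt_inv_le hl x) (h1.trans (le_abs_self C)) (norm_nonneg _)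
    (Real.exp_pos _).le

theorem nondegenerate_jost (q r : 𝓢(ℝ, ℂ)) (hδ : δ * δ = 1) {l₀ : ℂ}
    (h : 0 < δ * sgn i * l₀.im) : Nondegenerate (jost i δ q r) l₀ := by
  obtain ⟨x, hx⟩ := IsJost.exists_lower_bound (q := q) (r := r) (i := i) hδ
    (by positivity : 0 ≤ ‖l₀‖ + 2)
  refine ⟨x, i, 1 / 2 * Real.exp (-((‖l₀‖ + 2) ^ 2 * |x|)), by positivity, ?_⟩
  filter_upwards [eventually_norm_csqrt_le l₀, eventually_admissible h] with l hl hadm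
  have h1 := hx _ _ hl hadm (isJost_theFun hδ hadm)
  rw [norm_mul] at h1
  have h2 := h1.trans (mul_le_mul_of_nonneg_right (norm_wt_le hl x) (norm_nonneg _))
  rw [Real.exp_neg, ← div_eq_mul_inv, div_le_iff₀ (Real.exp_pos _), mul_comm]
  exact h2

theorem exists_bound_op_matTAt (hq : Continuous q) (hr : Continuous r) (Z x t : ℝ) :
    ∃ K, ∀ ζ : ℂ, ‖ζ‖ ≤ Z → ∀ s ∈ Set.uIcc 0 t, ‖op (matTAt ζ (q s) (r s) x)‖ ≤ K := by
  have hpoly : Continuous fun p : ℂ × ℂ × ℂ × ℂ × ℂ =>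
      op (matT p.1 p.2.1 p.2.2.1 p.2.2.2.1 p.2.2.2.2) := by
    refine continuous_op.comp (continuous_matrix fun i j => ?_)
    fin_cases i <;> fin_cases j <;> simp [matT] <;> fun_prop
  have h : ∀ {Q : ℝ → 𝓢(ℝ, ℂ)}, Continuous Q → Continuous fun p : ℂ × ℝ => Q p.2 x := fun hQ =>
    (continuous_eval_schwartz hQ).comp (by fun_prop : Continuous fun p : ℂ × ℝ => (x, p.2))
  have hc := hpoly.comp (continuous_fst.prodMk ((h hq).prodMk ((h hr).prodMk
    ((h (continuous_sderiv hq)).prodMk (h (continuous_sderiv hr))))))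
  obtain ⟨K, hK⟩ := ((isCompact_closedBall (0 : ℂ) Z).prod
    (isCompact_uIcc (a := (0 : ℝ)) (b := t))).exists_bound_of_continuousOn hc.continuousOn
  exact ⟨K, fun ζ hζ s hs => hK (ζ, s) ⟨by simpa using hζ, hs⟩⟩

/-- The Jost solutions i and 1 - i need opposite phases to evolve by 𝒯, and their quotient is
e^{4is_iλ²t}. For Γ fixed in time the combination of the two is again evolved by 𝒯, and Gronwall at
fixed x is uniform in ζ near √l₀. -/
theorem isEvolved_jost (hq : Continuous q) (hr : Continuous r) (hT : GovernedByT q r)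
    {l₀ : ℂ} (h : 0 < sgn i * l₀.im) (t : ℝ) :
    IsEvolved (4 * Complex.I * sgn i * t) (jost i 1 (q 0) (r 0)) (jost (1 - i) (-1) (q 0) (r 0))
      (jost i 1 (q t) (r t)) (jost (1 - i) (-1) (q t) (r t)) l₀ := by
  intro x
  set Z : ℝ := ‖l₀‖ + 2 with hZ
  obtain ⟨K, hK⟩ := exists_bound_op_matTAt hq hr Z x t
  refine ⟨Real.exp (2 * Z ^ 4 * |t|) * Real.exp (K * |t - 0|), ?_⟩
  filter_upwards [eventually_norm_csqrt_le l₀,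
    eventually_admissible (i := i) (δ := 1) (by simpa using h)] with l hl hadm Γ
  have hadm' : 0 ≤ -1 * sgn (1 - i) * (csqrt l ^ 2).im := by
    rw [sgn_compl]; simpa using hadm
  set ζ := csqrt l with hζ
  have hl2 : l ^ 2 = ζ ^ 4 := by rw [← csqrt_sq l]; ring
  have hF := fun t => hasDerivAt_jost hq hr hT (i := i) (δ := 1) (by norm_num) hadm x t
  have hG := fun t => hasDerivAt_jost hq hr hT (i := 1 - i) (δ := -1) (by norm_num) hadm' x t
  have hH : ∀ t : ℝ, HasDerivAt (fun t : ℝ =>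
      Complex.exp (-2 * Complex.I * sgn i * ζ ^ 4 * t) • jost i 1 (q t) (r t) ζ x
      - Γ • Complex.exp (-2 * Complex.I * sgn (1 - i) * ζ ^ 4 * t)
        • jost (1 - i) (-1) (q t) (r t) ζ x)
      (op (matTAt ζ (q t) (r t) x)
        (Complex.exp (-2 * Complex.I * sgn i * ζ ^ 4 * t) • jost i 1 (q t) (r t) ζ x
        - Γ • Complex.exp (-2 * Complex.I * sgn (1 - i) * ζ ^ 4 * t)
          • jost (1 - i) (-1) (q t) (r t) ζ x)) t := fun t => by
    refine ((hF t).fun_sub ((hG t).const_smul Γ)).congr_deriv ?_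
    simp only [op_apply, Matrix.mulVec_sub, Matrix.mulVec_smul]
  have hbound := norm_le_exp_of_linear_ode hH (t₀ := 0) (t₁ := t) (hK ζ hl)
  simp only [Complex.ofReal_zero, mul_zero, Complex.exp_zero, one_smul] at hbound
  -- Factoring out the phase of the first solution leaves the combination just estimated.
  have hfac : jost i 1 (q t) (r t) ζ x
        - (Complex.exp (4 * Complex.I * sgn i * t * l ^ 2) * Γ) • jost (1 - i) (-1) (q t) (r t) ζ x
      = Complex.exp (2 * Complex.I * sgn i * ζ ^ 4 * t) •
        (Complex.exp (-2 * Complex.I * sgn i * ζ ^ 4 * t) • jost i 1 (q t) (r t) ζ x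
        - Γ • Complex.exp (-2 * Complex.I * sgn (1 - i) * ζ ^ 4 * t)
          • jost (1 - i) (-1) (q t) (r t) ζ x) := by
    have e1 : Complex.exp (2 * Complex.I * sgn i * ζ ^ 4 * t)
        * Complex.exp (-2 * Complex.I * sgn i * ζ ^ 4 * t) = 1 := by
      rw [← Complex.exp_add, Complex.exp_eq_one_iff]
      exact ⟨0, by ring_nf⟩
    have e2 : Complex.exp (2 * Complex.I * sgn i * ζ ^ 4 * t)
        * Complex.exp (-2 * Complex.I * sgn (1 - i) * ζ ^ 4 * t)
        = Complex.exp (4 * Complex.I * sgn i * t * l ^ 2) := by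
      rw [← Complex.exp_add, sgn_compl, hl2]
      push_cast
      ring_nf
    rw [smul_sub, smul_smul, e1, one_smul, smul_comm Γ, smul_smul, e2, mul_smul]
  have hexp : ‖Complex.exp (2 * Complex.I * sgn i * ζ ^ 4 * t)‖ ≤ Real.exp (2 * Z ^ 4 * |t|) := by
    rw [Complex.norm_exp, Real.exp_le_exp]
    refine (Complex.re_le_norm _).trans ?_
    simp only [norm_mul, norm_pow, Complex.norm_real, Real.norm_eq_abs, abs_sgn, Complex.norm_I,
      Complex.norm_ofNat, mul_one]
    gcongr
  rw [hfac, norm_smul]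
  calc _ ≤ Real.exp (2 * Z ^ 4 * |t|) * (‖jost i 1 (q 0) (r 0) ζ x
        - Γ • jost (1 - i) (-1) (q 0) (r 0) ζ x‖ * Real.exp (K * |t - 0|)) := by gcongr
    _ = _ := by ring

end JostBoundStates

/-! ### Scattering coefficients and triplets in the unified notation -/

section Coefficients

variable {q r : ℝ → 𝓢(ℝ, ℂ)} {i : Fin 2} {δ : ℝ} {ζ : ℂ}

theorem neBot_endFilter (δ : ℝ) : (endFilter δ).NeBot := by
  unfold endFilter
  infer_instance

/-- The reciprocal of the transmission coefficient of the Jost solution of kind `(i, δ)`. -/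
noncomputable def mainCoeff (i : Fin 2) (δ : ℝ) (q r : ℝ → ℂ) (ζ : ℂ) : ℂ :=
  limUnder (endFilter δ) fun x => wt i ζ x * jost i δ q r ζ x i

/-- The ratio of the reflection and the transmission coefficient of the Jost solution of kind
`(i, δ)`. -/
noncomputable def crossCoeff (i : Fin 2) (δ : ℝ) (q r : ℝ → ℂ) (ζ : ℂ) : ℂ :=
  limUnder (endFilter δ) fun x => wt (1 - i) ζ x * jost i δ q r ζ x (1 - i)

theorem mainCoeff_eq (hq : Continuous q) (hr : Continuous r) (hT : GovernedByT q r)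
    (hδ : δ * δ = 1) (h : 0 ≤ δ * sgn i * (ζ ^ 2).im) (t : ℝ) :
    mainCoeff i δ (q t) (r t) ζ = mainCoeff i δ (q 0) (r 0) ζ := by
  have := neBot_endFilter δ
  obtain ⟨a, ha⟩ := (isJost_theFun (q := q 0) (r := r 0) hδ h).exists_tendsto hδ h
  have ht := exp_mul_jost_tendsto hq hr hT hδ h (fun _ => rfl) ha t
  rw [sub_self, mul_zero, zero_mul, zero_mul, Complex.exp_zero, one_mul] at ht
  exact ht.limUnder_eq.trans ha.limUnder_eq.symm

/-- For real ζ² both weights have modulus 1, so the weight of the other component is admissible in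
`exp_mul_jost_tendsto`; with k = 1 - i the phase difference s_i - s_k is 2s_i. -/
theorem crossCoeff_eq (hq : Continuous q) (hr : Continuous r) (hT : GovernedByT q r)
    (hδ : δ * δ = 1) (h : (ζ ^ 2).im = 0) (t : ℝ) :
    crossCoeff i δ (q t) (r t) ζ
      = Complex.exp (4 * Complex.I * sgn i * (ζ ^ 2) ^ 2 * t) * crossCoeff i δ (q 0) (r 0) ζ := by
  have := neBot_endFilter δ
  have h' : 0 ≤ δ * sgn i * (ζ ^ 2).im := by rw [h, mul_zero]
  obtain ⟨a, ha⟩ := (isJost_theFun (q := q 0) (r := r 0) hδ h').exists_tendsto_compl hδ h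
  have ht := exp_mul_jost_tendsto hq hr hT hδ h' (E := wt (1 - i) ζ)
    (fun x => by simp [norm_wt, h]) ha t
  have he : 2 * Complex.I * ((sgn i : ℂ) - sgn (1 - i)) * ζ ^ 4 * t
      = 4 * Complex.I * sgn i * (ζ ^ 2) ^ 2 * t := by
    rw [sgn_compl]
    push_cast
    ring
  rw [he] at ht
  exact ht.limUnder_eq.trans (by rw [crossCoeff, jost, ha.limUnder_eq])

theorem phi_eq : phi = jost 0 1 := by funext q r ζ; rw [phi, jost, isJostPhi_eq]

theorem phiBar_eq : phiBar = jost 1 1 := by funext q r ζ; rw [phiBar, jost, isJostPhiBar_eq]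

theorem psi_eq : psi = jost 1 (-1) := by funext q r ζ; rw [psi, jost, isJostPsi_eq]

theorem psiBar_eq : psiBar = jost 0 (-1) := by funext q r ζ; rw [psiBar, jost, isJostPsiBar_eq]

theorem Tr_eq (q r : ℝ → ℂ) (ζ : ℂ) : Tr q r ζ = (mainCoeff 0 1 q r ζ)⁻¹ := by
  rw [Tr, mainCoeff, endFilter_one, wt_zero, phi_eq]

theorem TrBar_eq (q r : ℝ → ℂ) (ζ : ℂ) : TrBar q r ζ = (mainCoeff 1 1 q r ζ)⁻¹ := by
  rw [TrBar, mainCoeff, endFilter_one, wt_one, phiBar_eq]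

theorem Tl_eq (q r : ℝ → ℂ) (ζ : ℂ) : Tl q r ζ = (mainCoeff 1 (-1) q r ζ)⁻¹ := by
  rw [Tl, mainCoeff, endFilter_neg_one, wt_one, psi_eq]

theorem TlBar_eq (q r : ℝ → ℂ) (ζ : ℂ) : TlBar q r ζ = (mainCoeff 0 (-1) q r ζ)⁻¹ := by
  rw [TlBar, mainCoeff, endFilter_neg_one, wt_zero, psiBar_eq]

theorem R_eq (q r : ℝ → ℂ) (ζ : ℂ) : R q r ζ = Tr q r ζ * crossCoeff 0 1 q r ζ := by
  rw [R, crossCoeff, endFilter_one, sub_zero, wt_one, phi_eq]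

theorem RBar_eq (q r : ℝ → ℂ) (ζ : ℂ) : RBar q r ζ = TrBar q r ζ * crossCoeff 1 1 q r ζ := by
  rw [RBar, crossCoeff, endFilter_one, sub_self, wt_zero, phiBar_eq]

theorem L_eq (q r : ℝ → ℂ) (ζ : ℂ) : L q r ζ = Tl q r ζ * crossCoeff 1 (-1) q r ζ := by
  rw [L, crossCoeff, endFilter_neg_one, sub_self, wt_zero, psi_eq]

theorem LBar_eq (q r : ℝ → ℂ) (ζ : ℂ) : LBar q r ζ = TlBar q r ζ * crossCoeff 0 (-1) q r ζ := by
  rw [LBar, crossCoeff, endFilter_neg_one, sub_zero, wt_one, psiBar_eq]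

theorem transmission_eq (hq : Continuous q) (hr : Continuous r) (hT : GovernedByT q r) (t : ℝ)
    (ζ : ℂ) :
    (0 ≤ (ζ ^ 2).im → Tl (q t) (r t) ζ = Tl (q 0) (r 0) ζ ∧ Tr (q t) (r t) ζ = Tr (q 0) (r 0) ζ) ∧
    ((ζ ^ 2).im ≤ 0 → TlBar (q t) (r t) ζ = TlBar (q 0) (r 0) ζ ∧
      TrBar (q t) (r t) ζ = TrBar (q 0) (r 0) ζ) := by
  simp only [Tl_eq, Tr_eq, TlBar_eq, TrBar_eq, inv_inj]
  refine ⟨fun h => ⟨?_, ?_⟩, fun h => ⟨?_, ?_⟩⟩ <;>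
    exact mainCoeff_eq hq hr hT (by norm_num) (by simpa [sgn] using h) t

theorem isTriplet_iff {q r : ℝ → ℂ} {N : ℕ} {lam : Fin N → ℂ} {m : Fin N → ℕ}
    {A : Matrix (Idx m) (Idx m) ℂ} {B : Matrix (Idx m) Unit ℂ} {C : Matrix Unit (Idx m) ℂ} :
    IsTriplet q r lam m A B C ↔ IsBoundStateTriplet (-Complex.I) (Tr q r) {l | 0 < l.im}
      (jost 0 1 q r) (jost 1 (-1) q r) lam m A B C := by
  rw [← phi_eq, ← psi_eq]
  rfl

theorem isTripletBar_iff {q r : ℝ → ℂ} {N : ℕ} {lam : Fin N → ℂ} {m : Fin N → ℕ}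
    {A : Matrix (Idx m) (Idx m) ℂ} {B : Matrix (Idx m) Unit ℂ} {C : Matrix Unit (Idx m) ℂ} :
    IsTripletBar q r lam m A B C ↔ IsBoundStateTriplet Complex.I (TrBar q r) {l | l.im < 0}
      (jost 1 1 q r) (jost 0 (-1) q r) lam m A B C := by
  rw [← phiBar_eq, ← psiBar_eq]
  rfl

theorem isBoundStateTriplet_jost_iff (hq : Continuous q) (hr : Continuous r)
    (hT : GovernedByT q r) {T : ℝ → ℂ → ℂ} {S : Set ℂ} (hS : S = {l | 0 < sgn i * l.im})
    (hTt : ∀ t, ∀ l ∈ S, T t (csqrt l) = T 0 (csqrt l)) {σ : ℂ} {N : ℕ} {lam : Fin N → ℂ}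
    {m : Fin N → ℕ} {A : Matrix (Idx m) (Idx m) ℂ} {B : Matrix (Idx m) Unit ℂ}
    {C : Matrix Unit (Idx m) ℂ}
    (h : IsBoundStateTriplet σ (T 0) S (jost i 1 (q 0) (r 0)) (jost (1 - i) (-1) (q 0) (r 0))
      lam m A B C) (t : ℝ) (A' : Matrix (Idx m) (Idx m) ℂ)
    (B' : Matrix (Idx m) Unit ℂ) (C' : Matrix Unit (Idx m) ℂ) :
    IsBoundStateTriplet σ (T t) S (jost i 1 (q t) (r t)) (jost (1 - i) (-1) (q t) (r t))
      lam m A' B' C' ↔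
      A' = A ∧ B' = B ∧ C' = C * NormedSpace.exp ((4 * Complex.I * sgn i * t : ℂ) • A ^ 2) := by
  have hpos : ∀ l ∈ S, 0 < -1 * sgn (1 - i) * l.im := fun l hl => by
    rw [sgn_compl]
    simpa [hS] using hl
  refine isBoundStateTriplet_iff ?_ ?_ (hTt t) (fun l hl => isEvolved_jost hq hr hT ?_ t)
    (fun l hl => eventually_norm_jost_le (q t) (r t) (by norm_num) (hpos l hl))
    (fun l hl => nondegenerate_jost (q t) (r t) (by norm_num) (hpos l hl)) h A' B' C'
  · rw [hS]
    exact isOpen_lt continuous_const (continuous_const.mul Complex.continuous_im)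
  · rintro l hl rfl
    simp [hS] at hl
  · simpa [hS] using hl

end Coefficients

end ChenLeeLiu

/-! ### Assembly of the theorem -/

open ChenLeeLiu
theorem theorem5p1 (q r : ℝ → 𝓢(ℝ, ℂ)) (hq : Continuous q) (hr : Continuous r)
    (hT : GovernedByT q r) :
    (∀ (t : ℝ) (ζ : ℂ), (ζ ^ 2).im = 0 →
      R (q t) (r t) ζ = R (q 0) (r 0) ζ * Complex.exp (4 * Complex.I * (ζ ^ 2) ^ 2 * t) ∧
      RBar (q t) (r t) ζ = RBar (q 0) (r 0) ζ * Complex.exp (-4 * Complex.I * (ζ ^ 2) ^ 2 * t) ∧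
      L (q t) (r t) ζ = L (q 0) (r 0) ζ * Complex.exp (-4 * Complex.I * (ζ ^ 2) ^ 2 * t) ∧
      LBar (q t) (r t) ζ = LBar (q 0) (r 0) ζ * Complex.exp (4 * Complex.I * (ζ ^ 2) ^ 2 * t)) ∧
    (∀ (t : ℝ) (ζ : ℂ),
      (0 ≤ (ζ ^ 2).im →
        Tl (q t) (r t) ζ = Tl (q 0) (r 0) ζ ∧ Tr (q t) (r t) ζ = Tr (q 0) (r 0) ζ) ∧
      ((ζ ^ 2).im ≤ 0 →
        TlBar (q t) (r t) ζ = TlBar (q 0) (r 0) ζ ∧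
        TrBar (q t) (r t) ζ = TrBar (q 0) (r 0) ζ)) ∧
    (∀ (N : ℕ) (lam : Fin N → ℂ) (m : Fin N → ℕ)
        (A : Matrix (Idx m) (Idx m) ℂ) (B : Matrix (Idx m) Unit ℂ) (C : Matrix Unit (Idx m) ℂ),
      IsTriplet (q 0) (r 0) lam m A B C →
      ∀ (t : ℝ) (A' : Matrix (Idx m) (Idx m) ℂ) (B' : Matrix (Idx m) Unit ℂ)
        (C' : Matrix Unit (Idx m) ℂ),
        IsTriplet (q t) (r t) lam m A' B' C' ↔
          A' = A ∧ B' = B ∧ C' = C * NormedSpace.exp ((4 * Complex.I * (t : ℂ)) • A ^ 2)) ∧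
    (∀ (N : ℕ) (lam : Fin N → ℂ) (m : Fin N → ℕ)
        (A : Matrix (Idx m) (Idx m) ℂ) (B : Matrix (Idx m) Unit ℂ) (C : Matrix Unit (Idx m) ℂ),
      IsTripletBar (q 0) (r 0) lam m A B C →
      ∀ (t : ℝ) (A' : Matrix (Idx m) (Idx m) ℂ) (B' : Matrix (Idx m) Unit ℂ)
        (C' : Matrix Unit (Idx m) ℂ),
        IsTripletBar (q t) (r t) lam m A' B' C' ↔
          A' = A ∧ B' = B ∧ C' = C * NormedSpace.exp ((-4 * Complex.I * (t : ℂ)) • A ^ 2)) := by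
  have htrans := transmission_eq hq hr hT
  refine ⟨fun t ζ h => ?_, htrans, fun N lam m A B C h t A' B' C' => ?_,
    fun N lam m A B C h t A' B' C' => ?_⟩
  · have hs0 : (sgn 0 : ℂ) = 1 := by simp [sgn]
    have hs1 : (sgn 1 : ℂ) = -1 := by simp [sgn]
    obtain ⟨hTl, hTr⟩ := (htrans t ζ).1 h.ge
    obtain ⟨hTlBar, hTrBar⟩ := (htrans t ζ).2 h.le
    have hcross := fun (i : Fin 2) (δ : ℝ) (hδ : δ * δ = 1) =>
      crossCoeff_eq hq hr hT (i := i) hδ h t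
    have e0 : 4 * Complex.I * sgn 0 * (ζ ^ 2) ^ 2 * t = 4 * Complex.I * (ζ ^ 2) ^ 2 * t := by
      rw [hs0]; ring
    have e1 : 4 * Complex.I * sgn 1 * (ζ ^ 2) ^ 2 * t = -4 * Complex.I * (ζ ^ 2) ^ 2 * t := by
      rw [hs1]; ring
    refine ⟨?_, ?_, ?_, ?_⟩
    · rw [R_eq, R_eq, hTr, hcross 0 1 (by norm_num), e0]; ring
    · rw [RBar_eq, RBar_eq, hTrBar, hcross 1 1 (by norm_num), e1]; ring
    · rw [L_eq, L_eq, hTl, hcross 1 (-1) (by norm_num), e1]; ring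
    · rw [LBar_eq, LBar_eq, hTlBar, hcross 0 (-1) (by norm_num), e0]; ring
  · rw [isTriplet_iff] at h ⊢
    have := isBoundStateTriplet_jost_iff (i := 0) hq hr hT (T := fun t => Tr (q t) (r t))
      (S := {l | 0 < l.im}) (by simp [sgn]) (fun t l hl => ((htrans t (csqrt l)).1 (by
        rw [csqrt_sq]; exact (show 0 < l.im from hl).le)).2) h t A' B' C'
    simpa [sgn] using this
  · rw [isTripletBar_iff] at h ⊢
    have := isBoundStateTriplet_jost_iff (i := 1) hq hr hT (T := fun t => TrBar (q t) (r t))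
      (S := {l | l.im < 0}) (by simp [sgn]) (fun t l hl => ((htrans t (csqrt l)).2 (by
        rw [csqrt_sq]; exact (show l.im < 0 from hl).le)).2) h t A' B' C'
    simpa [sgn] using this
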